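/- Let $H$ be a real Hilbert space and let $A$ be a positive self-adjoint operator in $H$ with compact inverse. Let $0<\lambda_1\le\lambda_2\le\cdots$ be its eigenvalues, enumerated with multiplicity in non-decreasing order, and $\{e_k\}_{k\ge1}$ a corresponding orthonormal basis of $H$ of eigenvectors. Put $H_0^1:=D(A^{1/2})$ with norm $\|u\|_{H_0^1}=\|A^{1/2}u\|_H$. Let $P_N$ be the orthoprojector of $H_0^1$ onto $P_N(H_0^1)=\mathrm{span}\{e_1,\dots,e_N\}$ and $Q_N=\mathrm{Id}-P_N$. For $\theta\in\mathbb R$ let $L^2_\theta(\mathbb R_-,H_0^1)$, $\mathbb R_-=(-\infty,0]$, be the space with norm $\|v\|^2_{L^2_\theta}=\int_{-\infty}^0 e^{2\theta t}\|v(t)\|^2_{H_0^1}\,dt$. Solutions of $\partial_t v+Av=h$, $t\le 0$, are functions $v\in C(\mathbb R_-,H_0^1)$ satisfying the equation in the weak sense, i.e. $\frac{d}{dt}(v,\varphi)_H+(v,A\varphi)_H=(h,\varphi)_H$ (integrated in time) for all $\varphi\in D(A)$. Let $n\in\mathbb N^+$, $L_1,L_2\ge 0$, and let $N_1,\dots,N_n\in\mathbb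 N^+$ satisfy the spectral gap condition $$\lambda_{N_i+1}-\lambda_{N_i}>(i-1)\lambda_{N_{i-1}}+\lambda_{N_i+1}^{1/2}(i+1)L_1+(i+1)L_2,\qquad i=1,\dots,n,\qquad \lambda_{N_0}:=0 .$$ Put $$\gamma=\min_{1\le i\le n}\frac{\lambda_{N_i+1}-\lambda_{N_i}-(i-1)\lambda_{N_{i-1}}-\lambda_{N_i+1}^{1/2}(i+1)L_1-(i+1)L_2}{i+1},\qquad \theta_i=\lambda_{N_i}+\gamma+\lambda_{N_i+1}^{1/2}L_1+L_2 .$$ Then there is $\varepsilon_0\in(0,1]$ such that for every $\varepsilon\in(0,\varepsilon_0)$, for all $F_1\in C_b^{n+1}(H_0^1,H)$ and $F_2\in C_b^{n+1}(H_0^1,H_0^1)$ with Lipschitz constants $L_1$ and $L_2$, and for each $i=1,\dots,n$, the following holds. For every $p\in P_{N_i}(H_0^1)$ the problem $$\partial_t v+Av=F_1(v)+F_2(v),\qquad P_{N_i}v|_{t=0}=p,\qquad t\le 0,$$ has a unique solution $v=V(p,\cdot)$ in $L^2_{\theta_i}(\mathbb R_-,H_0^1)$; with $M_{N_i}(p):=Q_{N_i}V(p,0)$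 and $\mathcal M_{N_i}:=\{V(p,0):p\in P_{N_i}(H_0^1)\}$ (the manifold built by the Perron method): (i) The map $V$ is $C^{1,\varepsilon}$-smooth in $p$, both as a map $p\mapsto V(p,t)\in H_0^1$ for each fixed $t\le 0$ and as a map $p\mapsto V(p,\cdot)\in L^2_{(1+\varepsilon)\theta_i}(\mathbb R_-,H_0^1)$. Consequently $\mathcal M_{N_i}=\{p+M_{N_i}(p):p\in P_{N_i}(H_0^1)\}$ is $C^{1,\varepsilon}$-smooth, i.e. $M_{N_i}:P_{N_i}(H_0^1)\to Q_{N_i}(H_0^1)$ is a $C^{1,\varepsilon}$ map. (Here $C^{1,\varepsilon}$ means $C^1$ with globally $\varepsilon$-Hölder continuous Fréchet derivative.) (ii) For all $p,\xi\in P_{N_i}(H_0^1)$, $M_{N_i}'(p)\xi=Q_{N_i}V'_\xi(0)$, where $V'_\xi(t):=V'(p,t)\xi$ is the Fréchet derivative of $V(\cdot,t)$ at $p$ in the direction $\xi$, and $V'_\xi$ is the unique solution in $L^2_{\theta_i}(\mathbb R_-,H_0^1)$ of the equation of variations $$\partial_t V'_\xi+AV'_\xi-\bigl(F_1'(v)V'_\xi+F_2'(v)V'_\xi\bigr)=0,\qquad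 P_{N_i}V'_\xi|_{t=0}=\xi,\qquad t\le 0,\qquad v=V(p,\cdot).$$ (iii) There is a constant $C$ such that for all $p_1,p_2\in P_{N_i}(H_0^1)$, with $\xi=p_2-p_1$, $$\|V(p_2,\cdot)-V(p_1,\cdot)-V'(p_1,\cdot)\xi\|_{L^2_{(1+\varepsilon)\theta_i}(\mathbb R_-,H_0^1)}\le C\|p_2-p_1\|_{H_0^1}^{1+\varepsilon}.$$ -/

import Mathlib

open MeasureTheory Set
open scoped NNReal RealInnerProductSpace

noncomputable section

namespace InertialManifold

/-- A (possibly unbounded) positive self-adjoint operator `A : D(A) ⊆ H → H` with compact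
inverse on a real Hilbert space. -/
structure PosSelfAdjointOp (H : Type*) [NormedAddCommGroup H] [InnerProductSpace ℝ H]
    [CompleteSpace H] where
  /-- the operator together with its domain -/
  op : H →ₗ.[ℝ] H
  dense_domain : Dense (op.domain : Set H)
  selfAdjoint : IsSelfAdjoint op
  positive : ∀ x : op.domain, (x : H) ≠ 0 → 0 < ⟪op x, (x : H)⟫
  compact_inverse : ∃ K : H →L[ℝ] H, IsCompactOperator K ∧
    (∀ y : H, ∃ h : K y ∈ op.domain, op ⟨K y, h⟩ = y) ∧ ∀ x : op.domain, K (op x) = x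

/-- The eigenvalues of `A`, listed with multiplicity in non-decreasing order, and an orthonormal
basis of `H` formed by corresponding eigenvectors. The lists start at index `0`, that is,
`eigval k` is `λ_{k+1}` and `basis k` is `e_{k+1}`. -/
structure EigenSystem {H : Type*} [NormedAddCommGroup H] [InnerProductSpace ℝ H]
    [CompleteSpace H] (A : PosSelfAdjointOp H) where
  eigval : ℕ → ℝ
  basis : HilbertBasis ℕ ℝ H
  mono : Monotone eigval
  basis_mem : ∀ k, basis k ∈ A.op.domain
  op_basis : ∀ k, A.op ⟨basis k, basis_mem k⟩ = eigval k • basis k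

namespace EigenSystem

variable {H : Type*} [NormedAddCommGroup H] [InnerProductSpace ℝ H] [CompleteSpace H]
  {A : PosSelfAdjointOp H} (E : EigenSystem A)

/-- `λ_N` with the numbering `λ_1 ≤ λ_2 ≤ …`, and `λ_0 = 0`. -/
def lam : ℕ → ℝ
  | 0 => 0
  | k + 1 => E.eigval k

lemma eigval_pos (k : ℕ) : 0 < E.eigval k := by
  have hn : ‖E.basis k‖ = 1 := E.basis.orthonormal.1 k
  have h := A.positive ⟨E.basis k, E.basis_mem k⟩ (by
    intro h0
    simp only at h0
    rw [h0, norm_zero] at hn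
    exact zero_ne_one hn)
  rw [E.op_basis, real_inner_smul_left, real_inner_self_eq_norm_sq, hn] at h
  simpa using h

/-- The domain of `A^{1/2}`: all `u ∈ H` with `∑ λ_k ⟪e_k, u⟫² < ∞`. -/
def sqrtDomain : Submodule ℝ H where
  carrier := {u | Memℓp (fun k => √(E.eigval k) * E.basis.repr u k) 2}
  zero_mem' := by
    have h : (fun k => √(E.eigval k) * E.basis.repr (0 : H) k) = (0 : ℕ → ℝ) := by
      funext k; simp
    simp only [mem_ofPred_eq, h]
    exact zero_memℓp
  add_mem' := by
    intro u v hu hv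
    have h : (fun k => √(E.eigval k) * E.basis.repr (u + v) k) =
        (fun k => √(E.eigval k) * E.basis.repr u k) +
          fun k => √(E.eigval k) * E.basis.repr v k := by
      funext k; simp [mul_add]
    simp only [mem_ofPred_eq, h]
    exact hu.add hv
  smul_mem' := by
    intro c u hu
    have h : (fun k => √(E.eigval k) * E.basis.repr (c • u) k) =
        c • fun k => √(E.eigval k) * E.basis.repr u k := by
      funext k; simp; ring
    simp only [mem_ofPred_eq, h]
    exact hu.const_smul c

/-- The space `H_0^1 := D(A^{1/2})`; its norm is `‖A^{1/2} u‖` (see below), not the norm of `H`. -/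
def H1 : Type _ := E.sqrtDomain

instance : AddCommGroup E.H1 := inferInstanceAs (AddCommGroup E.sqrtDomain)

instance : Module ℝ E.H1 := inferInstanceAs (Module ℝ E.sqrtDomain)

/-- The embedding of `H_0^1` into `H`. -/
def incl : E.H1 →ₗ[ℝ] H := E.sqrtDomain.subtype

/-- The operator `A^{1/2} : H_0^1 → H`, `u ↦ ∑ λ_k^{1/2} ⟪e_k, u⟫ e_k`. -/
def sqrtOp : E.H1 →ₗ[ℝ] H where
  toFun u := E.basis.repr.symm ⟨fun k => √(E.eigval k) * E.basis.repr (E.incl u) k, u.2⟩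
  map_add' u v := by
    rw [← map_add]
    congr 1
    ext k
    simp only [map_add, lp.coeFn_add, Pi.add_apply, mul_add]
  map_smul' c u := by
    rw [RingHom.id_apply, ← map_smul]
    congr 1
    ext k
    simp
    ring

lemma repr_sqrtOp (u : E.H1) (k : ℕ) :
    E.basis.repr (E.sqrtOp u) k = √(E.eigval k) * E.basis.repr (E.incl u) k := by
  simp [sqrtOp]

lemma sqrtOp_eq_zero {u : E.H1} (h : E.sqrtOp u = 0) : u = 0 := by
  apply Subtype.ext
  change E.incl u = 0
  apply E.basis.repr.injective
  ext k
  have hk := E.repr_sqrtOp u k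
  rw [h] at hk
  have hs : √(E.eigval k) ≠ 0 := (Real.sqrt_pos.2 (E.eigval_pos k)).ne'
  have h0 : (0 : ℝ) = √(E.eigval k) * E.basis.repr (E.incl u) k := by simpa using hk
  simpa [hs] using h0.symm

/-- The inner product `⟪A^{1/2} u, A^{1/2} v⟫` of `H_0^1`. -/
@[reducible]
def h1Core : InnerProductSpace.Core ℝ E.H1 where
  inner u v := ⟪E.sqrtOp u, E.sqrtOp v⟫
  conj_inner_symm u v := by simp [real_inner_comm]
  re_inner_nonneg u := by simp
  add_left u v w := by simp [inner_add_left]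
  smul_left u v c := by simp [real_inner_smul_left]
  definite u h := E.sqrtOp_eq_zero (inner_self_eq_zero.1 h)

instance : NormedAddCommGroup E.H1 := E.h1Core.toNormedAddCommGroup

instance : InnerProductSpace ℝ E.H1 := InnerProductSpace.ofCore E.h1Core.toCore

lemma basis_mem_sqrtDomain (k : ℕ) : E.basis k ∈ E.sqrtDomain := by
  have h : (fun j => √(E.eigval j) * E.basis.repr (E.basis k) j) =
      ⇑(lp.single 2 k (√(E.eigval k)) : lp (fun _ : ℕ => ℝ) 2) := by
    funext j
    rw [E.basis.repr_self]
    by_cases hj : j = k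
    · subst hj; simp
    · simp [lp.single_apply, hj]
  change Memℓp (fun j => √(E.eigval j) * E.basis.repr (E.basis k) j) 2
  rw [h]
  exact lp.memℓp _

/-- The eigenvector `e_{k+1}` as an element of `H_0^1`. -/
def eigvec (k : ℕ) : E.H1 := (⟨E.basis k, E.basis_mem_sqrtDomain k⟩ : E.sqrtDomain)

/-- `P_N(H_0^1) = span {e_1, …, e_N}`, with the norm of `H_0^1`. The projectors `P_N` and `Q_N` are
the orthogonal projections of `H_0^1` onto this space and onto its orthogonal complement. -/
def PN (N : ℕ) : Submodule ℝ E.H1 := Submodule.span ℝ (range fun k : Fin N => E.eigvec k)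

instance (N : ℕ) : FiniteDimensional ℝ (E.PN N) :=
  FiniteDimensional.span_of_finite ℝ (finite_range _)

/-- `v ∈ C(ℝ₋, H_0^1)` is a solution of `∂_t v + A v = h` for `t ≤ 0`, in the weak sense: for every
`φ ∈ D(A)`, `d/dt ⟪v, φ⟫ + ⟪v, A φ⟫ = ⟪h, φ⟫`, integrated over `[s, t]`. -/
def IsSolution (h : ℝ → H) (v : ℝ → E.H1) : Prop :=
  ContinuousOn v (Iic 0) ∧
  ∀ (φ : A.op.domain) (s t : ℝ), s ≤ t → t ≤ 0 →
    ⟪E.incl (v t), (φ : H)⟫ - ⟪E.incl (v s), (φ : H)⟫ + ∫ τ in s..t, ⟪E.incl (v τ), A.op φ⟫ =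
      ∫ τ in s..t, ⟪h τ, (φ : H)⟫

end EigenSystem

/-- The measure `e^{2θt} dt` on `ℝ₋ = (-∞, 0]`, so that `L²_θ(ℝ₋, X)` is the space of `L²`
functions with values in `X` for this measure. -/
def expWeight (θ : ℝ) : Measure ℝ :=
  (volume.restrict (Iic 0)).withDensity fun t => ENNReal.ofReal (Real.exp (2 * θ * t))

/-- `F ∈ C_b^k(X, Y)`: `F` is `C^k`, and `F` and its derivatives up to order `k` are bounded. -/
def IsCb {X Y : Type*} [NormedAddCommGroup X] [NormedSpace ℝ X] [NormedAddCommGroup Y]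
    [NormedSpace ℝ Y] (k : ℕ) (F : X → Y) : Prop :=
  ContDiff ℝ k F ∧ ∀ j ≤ k, ∃ C : ℝ, ∀ x, ‖iteratedFDeriv ℝ j F x‖ ≤ C

/-- `f ∈ C^{1,α}(X, Y)`: `f` is `C^1` and its Fréchet derivative is Hölder continuous with
exponent `α` on `X`. -/
def IsC1Holder {X Y : Type*} [NormedAddCommGroup X] [NormedSpace ℝ X] [NormedAddCommGroup Y]
    [NormedSpace ℝ Y] (α : ℝ) (f : X → Y) : Prop :=
  ContDiff ℝ 1 f ∧ ∃ C : ℝ, ∀ x y, ‖fderiv ℝ f x - fderiv ℝ f y‖ ≤ C * ‖x - y‖ ^ α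

namespace EigenSystem

variable {H : Type*} [NormedAddCommGroup H] [InnerProductSpace ℝ H] [CompleteSpace H]
  {A : PosSelfAdjointOp H} (E : EigenSystem A)

/-- The quantity
`λ_{N_i+1} - λ_{N_i} - (i-1) λ_{N_{i-1}} - λ_{N_i+1}^{1/2} (i+1) L₁ - (i+1) L₂`. -/
def gapExcess (N : ℕ → ℕ) (L₁ L₂ : ℝ≥0) (i : ℕ) : ℝ :=
  E.lam (N i + 1) - E.lam (N i) - ((i : ℝ) - 1) * E.lam (N (i - 1))
    - √(E.lam (N i + 1)) * ((i : ℝ) + 1) * L₁ - ((i : ℝ) + 1) * L₂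

/-- `γ`, the minimum over `i = 1, …, n` of the gap excess divided by `i + 1`. -/
def gapGamma {n : ℕ} (hn : 1 ≤ n) (N : ℕ → ℕ) (L₁ L₂ : ℝ≥0) : ℝ :=
  (Finset.Icc 1 n).inf' (Finset.nonempty_Icc.2 hn)
    fun i => E.gapExcess N L₁ L₂ i / ((i : ℝ) + 1)

/-- `θ_i = λ_{N_i} + γ + λ_{N_i+1}^{1/2} L₁ + L₂`. -/
def theta {n : ℕ} (hn : 1 ≤ n) (N : ℕ → ℕ) (L₁ L₂ : ℝ≥0) (i : ℕ) : ℝ :=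
  E.lam (N i) + E.gapGamma hn N L₁ L₂ + √(E.lam (N i + 1)) * L₁ + L₂

variable (F₁ : E.H1 → H) (F₂ : E.H1 → E.H1) (θ : ℝ) (N : ℕ)

/-- `v ∈ L²_θ(ℝ₋, H_0^1)` solves the backward problem
`∂_t v + A v = F₁(v) + F₂(v)`, `P_N v|_{t=0} = p`, `t ≤ 0`. -/
def IsPerronSolution (p : E.PN N) (v : ℝ → E.H1) : Prop :=
  MemLp v 2 (expWeight θ) ∧
  E.IsSolution (fun t => F₁ (v t) + E.incl (F₂ (v t))) v ∧
  (E.PN N).orthogonalProjectionOnto (v 0) = p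

/-- `w ∈ L²_θ(ℝ₋, H_0^1)` solves the equation of variations along `v`:
`∂_t w + A w - (F₁'(v) w + F₂'(v) w) = 0`, `P_N w|_{t=0} = ξ`, `t ≤ 0`. -/
def IsVariationSolution (v : ℝ → E.H1) (ξ : E.PN N) (w : ℝ → E.H1) : Prop :=
  MemLp w 2 (expWeight θ) ∧
  E.IsSolution (fun t => fderiv ℝ F₁ (v t) (w t) + E.incl (fderiv ℝ F₂ (v t) (w t))) w ∧
  (E.PN N).orthogonalProjectionOnto (w 0) = ξ

/-- `V` is the map `(p, t) ↦ V(p, t)` of the Perron method: `V(p, ·)` is the unique solution on `ℝ₋`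
of the backward problem in `L²_θ(ℝ₋, H_0^1)`. -/
def IsPerronMap (V : E.PN N → ℝ → E.H1) : Prop :=
  ∀ p, E.IsPerronSolution F₁ F₂ θ N p (V p) ∧
    ∀ v, E.IsPerronSolution F₁ F₂ θ N p v → EqOn v (V p) (Iic 0)

variable {E N}

/-- `M_N : P_N(H_0^1) → Q_N(H_0^1)`, `M_N(p) = Q_N V(p, 0)`. -/
def graphMap (V : E.PN N → ℝ → E.H1) (p : E.PN N) : (E.PN N)ᗮ :=
  (E.PN N)ᗮ.orthogonalProjectionOnto (V p 0)

/-- `V'(p, t) ξ`, the Fréchet derivative of `q ↦ V(q, t)` at `p` applied to `ξ`. -/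
def derivV (V : E.PN N → ℝ → E.H1) (p ξ : E.PN N) (t : ℝ) : E.H1 :=
  fderiv ℝ (fun q => V q t) p ξ

end EigenSystem

end InertialManifold

end

open InertialManifold

open scoped ENNReal
open InertialManifold

noncomputable section

namespace InertialManifold

/-! ### The weighted spaces -/

section Weighted

variable {X Y : Type*} [NormedAddCommGroup X] [NormedAddCommGroup Y]

/-! In the eigenbasis the linear equation splits into scalar modes u' + λ_k u = h on ℝ₋. A mode with
λ_k < θ is determined by its value at 0. A mode with λ_k > θ is determined by the absence of growth
at -∞: the homogeneous solution e^{-λ_k t} is not in L²_θ. After multiplication by e^{θt} both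
Green's functions become one-sided exponentials of rate |λ_k - θ|, so the solution operator of the
mode has norm at most 1/|λ_k - θ| in L²_θ. If θ has distance at least d from the spectrum and N
eigenvalues lie below it, summing the modes gives the norms √λ_{N+1}/d from H to H_0^1 and 1/d on
H_0^1.

Put a = √λ_{N+1} L₁ + L₂. When a < d, the integral equation is a contraction in L²_θ
(`Dichotomy.exists_integral_solution`). By the same estimate, solutions of the equation of
variations are controlled by forcing and initial value, both in L²_θ and pointwise with growth
e^{-θt} (`Dichotomy.exists_apriori`). Mode by mode, the integral equation is equivalent to the weak
formulation within L²_θ (`Dichotomy.isSolution_of_integralSol`,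
`Dichotomy.integralSol_of_isSolution`).

For smoothness, let w solve the equation of variations along V(p₁) with initial value p₂ - p₁. The
remainder V(p₂) - V(p₁) - w solves the same equation with zero initial value, forced by a Taylor
remainder of size ‖V(p₂) - V(p₁)‖^{1+ε}. One factor of this is measured in L²_θ. The other, raised
to the power ε, is bounded by a multiple of e^{-εθt}, so the forcing is O(‖p₂ - p₁‖^{1+ε}) in
L²_{(1+ε)θ}. The linear estimate therefore has to be available at the weight (1+ε)θ as well. This
yields `Dichotomy.exists_taylor`; replacing one base point by another in the linearization yields
`Dichotomy.exists_linearized_holder` in the same way. Together they give C^{1,ε} by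
`isC1Holder_of_taylor`.

The gap condition places θ_i at distance at least γ + a from the spectrum (`dichotomy_of_gap`).
Raising θ_i by εθ_i < γ leaves a distance larger than a, and this is the restriction on ε. -/

/-- The square of the norm of `L²_θ(ℝ₋, X)`. -/
def wsq (θ : ℝ) (f : ℝ → X) : ℝ≥0∞ :=
  ∫⁻ t in Iic 0, (ENNReal.ofReal (Real.exp (θ * t)) * ‖f t‖ₑ) ^ 2

lemma expWeight_ac (θ : ℝ) : expWeight θ ≪ volume.restrict (Iic 0) :=
  withDensity_absolutelyContinuous _ _

/-- The density is strictly positive, so every weighted measure has the null sets of Lebesgue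
measure on ℝ₋. Measurability and almost everywhere identities can then be stated without the weight.
-/
lemma ac_expWeight (θ : ℝ) : volume.restrict (Iic 0) ≪ expWeight θ := by
  refine withDensity_absolutelyContinuous' (by fun_prop) (ae_of_all _ fun t => ?_)
  simpa using Real.exp_pos _

lemma aestronglyMeasurable_expWeight_iff {θ : ℝ} {f : ℝ → X} :
    AEStronglyMeasurable f (expWeight θ) ↔ AEStronglyMeasurable f (volume.restrict (Iic 0)) :=
  ⟨fun h => h.mono_ac (ac_expWeight θ), fun h => h.mono_ac (expWeight_ac θ)⟩

lemma ae_expWeight_of_forall {θ : ℝ} {p : ℝ → Prop} (h : ∀ t ≤ 0, p t) :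
    ∀ᵐ t ∂expWeight θ, p t :=
  (expWeight_ac θ).ae_le ((ae_restrict_iff' measurableSet_Iic).2 (ae_of_all _ h))

lemma ae_restrict_of_ae_expWeight {θ : ℝ} {p : ℝ → Prop} (h : ∀ᵐ t ∂expWeight θ, p t) :
    ∀ᵐ t ∂volume.restrict (Iic (0 : ℝ)), p t :=
  (ac_expWeight θ).ae_le h

lemma lintegral_expWeight (θ : ℝ) (f : ℝ → ℝ≥0∞) :
    ∫⁻ t, f t ∂expWeight θ = ∫⁻ t in Iic 0, ENNReal.ofReal (Real.exp (2 * θ * t)) * f t := by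
  rw [expWeight, lintegral_withDensity_eq_lintegral_mul_non_measurable _ (by fun_prop)
    (ae_of_all _ fun t => ENNReal.ofReal_lt_top)]
  rfl

lemma eLpNorm_sq (θ : ℝ) (f : ℝ → X) : eLpNorm f 2 (expWeight θ) ^ 2 = wsq θ f := by
  rw [eLpNorm_eq_lintegral_rpow_enorm_toReal (by simp) (by simp), ← ENNReal.rpow_natCast,
    ← ENNReal.rpow_mul, lintegral_expWeight, wsq]
  simp only [ENNReal.toReal_ofNat, Nat.cast_ofNat, one_div]
  rw [inv_mul_cancel₀ (by norm_num), ENNReal.rpow_one]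
  refine lintegral_congr fun t => ?_
  rw [mul_pow, ← ENNReal.ofReal_pow (Real.exp_pos _).le, ← Real.exp_nat_mul, ENNReal.rpow_ofNat]
  congr 3
  push_cast; ring

lemma memLp_iff_wsq {θ : ℝ} {f : ℝ → X} :
    MemLp f 2 (expWeight θ) ↔
      AEStronglyMeasurable f (volume.restrict (Iic 0)) ∧ wsq θ f < ∞ := by
  rw [MemLp, aestronglyMeasurable_expWeight_iff, ← eLpNorm_sq, ENNReal.pow_lt_top_iff]
  simp

lemma eLpNorm_le_of_wsq_le {θ : ℝ} {f : ℝ → X} {g : ℝ → Y} {θ' : ℝ} {c : ℝ≥0∞}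
    (h : wsq θ f ≤ c ^ 2 * wsq θ' g) :
    eLpNorm f 2 (expWeight θ) ≤ c * eLpNorm g 2 (expWeight θ') := by
  rw [← eLpNorm_sq, ← eLpNorm_sq, ← mul_pow] at h
  exact (ENNReal.pow_le_pow_left_iff two_ne_zero).1 h

lemma wsq_le_of_forall {θ θ' : ℝ} {f : ℝ → X} {g : ℝ → Y} {c : ℝ} (hc : 0 ≤ c)
    (h : ∀ t ≤ 0, Real.exp (θ * t) * ‖f t‖ ≤ c * (Real.exp (θ' * t) * ‖g t‖)) :
    wsq θ f ≤ ENNReal.ofReal c ^ 2 * wsq θ' g := by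
  rw [wsq, wsq, ← lintegral_const_mul' _ _ (by finiteness)]
  refine setLIntegral_mono' measurableSet_Iic fun t ht => ?_
  rw [← mul_pow]
  refine pow_le_pow_left' ?_ 2
  rw [← ofReal_norm, ← ofReal_norm, ← ENNReal.ofReal_mul (Real.exp_pos _).le,
    ← ENNReal.ofReal_mul (Real.exp_pos _).le, ← ENNReal.ofReal_mul hc]
  exact ENNReal.ofReal_le_ofReal (h t ht)

lemma eLpNorm_expWeight_le {θ θ' : ℝ} {f : ℝ → X} {g : ℝ → Y} {c : ℝ} (hc : 0 ≤ c)
    (h : ∀ t ≤ 0, Real.exp (θ * t) * ‖f t‖ ≤ c * (Real.exp (θ' * t) * ‖g t‖)) :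
    eLpNorm f 2 (expWeight θ) ≤ ENNReal.ofReal c * eLpNorm g 2 (expWeight θ') :=
  eLpNorm_le_of_wsq_le (wsq_le_of_forall hc h)

lemma memLp_of_forall {θ θ' : ℝ} {f : ℝ → X} {g : ℝ → Y} {c : ℝ} (hc : 0 ≤ c)
    (hf : AEStronglyMeasurable f (volume.restrict (Iic 0))) (hg : MemLp g 2 (expWeight θ'))
    (h : ∀ t ≤ 0, Real.exp (θ * t) * ‖f t‖ ≤ c * (Real.exp (θ' * t) * ‖g t‖)) :
    MemLp f 2 (expWeight θ) :=
  ⟨aestronglyMeasurable_expWeight_iff.2 hf, (eLpNorm_expWeight_le hc h).trans_lt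
    (ENNReal.mul_lt_top ENNReal.ofReal_lt_top hg.2)⟩

/-- For t ≤ 0 the factor e^{θt} decreases in θ, so a larger θ allows more growth at -∞. This moves
solutions from the weight θ to (1+ε)θ. -/
lemma memLp_expWeight_mono {θ θ' : ℝ} (h : θ ≤ θ') {f : ℝ → X} (hf : MemLp f 2 (expWeight θ)) :
    MemLp f 2 (expWeight θ') := by
  refine memLp_of_forall zero_le_one (aestronglyMeasurable_expWeight_iff.1 hf.1) hf fun t ht => ?_
  rw [one_mul]
  gcongr ?_ * _
  exact Real.exp_le_exp.2 (mul_le_mul_of_nonpos_right h ht)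

end Weighted

/-! ### Exponential kernels -/

lemma lintegral_exp_Iic {δ : ℝ} (hδ : 0 < δ) (a : ℝ) :
    ∫⁻ x in Iic a, ENNReal.ofReal (Real.exp (-δ * |x - a|)) = ENNReal.ofReal (1 / δ) := by
  have h1 : ∫⁻ x in Iic a, ENNReal.ofReal (Real.exp (-δ * |x - a|)) =
      ∫⁻ x in Iic a, ENNReal.ofReal (Real.exp (-δ * a)) * ENNReal.ofReal (Real.exp (δ * x)) := by
    refine setLIntegral_congr_fun measurableSet_Iic fun x hx => ?_
    simp only [mem_Iic] at hx
    rw [← ENNReal.ofReal_mul (Real.exp_pos _).le, ← Real.exp_add, abs_of_nonpos (by linarith)]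
    congr 2; ring
  rw [h1, lintegral_const_mul' _ _ (by finiteness),
    ← ofReal_integral_eq_lintegral_ofReal (integrableOn_exp_mul_Iic hδ _)
      (ae_of_all _ fun _ => (Real.exp_pos _).le), integral_exp_mul_Iic hδ,
    ← ENNReal.ofReal_mul (Real.exp_pos _).le]
  congr 1
  rw [← mul_div_assoc, ← Real.exp_add]
  simp

lemma lintegral_exp_Ioi {δ : ℝ} (hδ : 0 < δ) (a : ℝ) :
    ∫⁻ x in Ioi a, ENNReal.ofReal (Real.exp (-δ * |x - a|)) = ENNReal.ofReal (1 / δ) := by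
  have h1 : ∫⁻ x in Ioi a, ENNReal.ofReal (Real.exp (-δ * |x - a|)) =
      ∫⁻ x in Ioi a, ENNReal.ofReal (Real.exp (δ * a)) * ENNReal.ofReal (Real.exp (-δ * x)) := by
    refine setLIntegral_congr_fun measurableSet_Ioi fun x hx => ?_
    simp only [mem_Ioi] at hx
    rw [← ENNReal.ofReal_mul (Real.exp_pos _).le, ← Real.exp_add, abs_of_pos (by linarith)]
    congr 2; ring
  have hδ' : -δ < 0 := by linarith
  rw [h1, lintegral_const_mul' _ _ (by finiteness),
    ← ofReal_integral_eq_lintegral_ofReal (integrableOn_exp_mul_Ioi hδ' _)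
      (ae_of_all _ fun _ => (Real.exp_pos _).le), integral_exp_mul_Ioi hδ',
    ← ENNReal.ofReal_mul (Real.exp_pos _).le]
  congr 1
  rw [neg_div_neg_eq, ← mul_div_assoc, ← Real.exp_add]
  simp

/-- The set of times `s` on which the solution of a mode at time `t` depends: the future for modes
prescribed at `0` (`b = true`), the past for the others. -/
def kernelDomain (b : Bool) : Set (ℝ × ℝ) :=
  {q | if b then q.1 < q.2 else q.2 ≤ q.1}

lemma measurableSet_kernelDomain (b : Bool) : MeasurableSet (kernelDomain b) := by
  cases b
  · simpa [kernelDomain] using measurableSet_le measurable_snd measurable_fst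
  · simpa [kernelDomain] using measurableSet_lt measurable_fst measurable_snd

/-- One-sided exponential kernel with decay rate `δ`. -/
def expKernel (b : Bool) (δ : ℝ) : ℝ × ℝ → ℝ≥0∞ :=
  (kernelDomain b).indicator fun q => ENNReal.ofReal (Real.exp (-δ * |q.2 - q.1|))

lemma measurable_expKernel (b : Bool) (δ : ℝ) : Measurable (expKernel b δ) :=
  Measurable.indicator (by fun_prop) (measurableSet_kernelDomain b)

lemma expKernel_mul_self (b : Bool) (δ : ℝ) (q : ℝ × ℝ) :
    expKernel b δ q ^ 2 = expKernel b (2 * δ) q := by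
  by_cases hq : q ∈ kernelDomain b
  · rw [expKernel, expKernel, indicator_of_mem hq, indicator_of_mem hq,
      ← ENNReal.ofReal_pow (Real.exp_pos _).le, ← Real.exp_nat_mul]
    congr 2; push_cast; ring
  · rw [expKernel, expKernel, indicator_of_notMem hq, indicator_of_notMem hq]; simp

lemma lintegral_expKernel_right (b : Bool) {δ : ℝ} (hδ : 0 < δ) (t : ℝ) :
    ∫⁻ s, expKernel b δ (t, s) = ENNReal.ofReal (1 / δ) := by
  cases b
  · rw [← lintegral_exp_Iic hδ t, ← lintegral_indicator measurableSet_Iic]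
    simp [expKernel, kernelDomain, indicator]
  · rw [← lintegral_exp_Ioi hδ t, ← lintegral_indicator measurableSet_Ioi]
    simp [expKernel, kernelDomain, indicator]

lemma lintegral_expKernel_left (b : Bool) {δ : ℝ} (hδ : 0 < δ) (s : ℝ) :
    ∫⁻ t, expKernel b δ (t, s) = ENNReal.ofReal (1 / δ) := by
  cases b
  · rw [← lintegral_exp_Ioi hδ s, setLIntegral_congr Ioi_ae_eq_Ici,
      ← lintegral_indicator measurableSet_Ici]
    simp [expKernel, kernelDomain, indicator, abs_sub_comm s]
  · rw [← lintegral_exp_Iic hδ s, ← setLIntegral_congr Iio_ae_eq_Iic,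
      ← lintegral_indicator measurableSet_Iio]
    simp [expKernel, kernelDomain, indicator, abs_sub_comm s]

lemma sq_lintegral_mul_le {α : Type*} [MeasurableSpace α] {μ : Measure α} {f g : α → ℝ≥0∞}
    (hf : AEMeasurable f μ) (hg : AEMeasurable g μ) :
    (∫⁻ a, f a * g a ∂μ) ^ 2 ≤ (∫⁻ a, f a ^ 2 ∂μ) * ∫⁻ a, g a ^ 2 ∂μ := by
  have h := ENNReal.lintegral_mul_le_Lp_mul_Lq μ Real.HolderConjugate.two_two hf hg
  calc (∫⁻ a, f a * g a ∂μ) ^ 2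
      ≤ ((∫⁻ a, f a ^ (2 : ℝ) ∂μ) ^ (1 / 2 : ℝ) * (∫⁻ a, g a ^ (2 : ℝ) ∂μ) ^ (1 / 2 : ℝ)) ^ 2 := by
        gcongr; exact h
    _ = _ := by
        rw [mul_pow, ← ENNReal.rpow_natCast, ← ENNReal.rpow_natCast, ← ENNReal.rpow_mul,
          ← ENNReal.rpow_mul]
        simp

/-- Cauchy–Schwarz: the square of the kernel is the kernel of rate 2δ, whose mass is 1/(2δ). This is
the source of all pointwise bounds. -/
lemma sq_lintegral_expKernel_le (b : Bool) {δ : ℝ} (hδ : 0 < δ) {f : ℝ → ℝ≥0∞}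
    (hf : AEMeasurable f (volume.restrict (Iic 0))) (t : ℝ) :
    (∫⁻ s in Iic 0, expKernel b δ (t, s) * f s) ^ 2 ≤
      ENNReal.ofReal (1 / (2 * δ)) * ∫⁻ s in Iic 0, f s ^ 2 := by
  have hm : Measurable fun s => expKernel b δ (t, s) :=
    (measurable_expKernel b δ).comp (by fun_prop)
  refine (sq_lintegral_mul_le hm.aemeasurable hf).trans ?_
  gcongr
  simp_rw [expKernel_mul_self]
  exact (setLIntegral_le_lintegral _ _).trans
    (lintegral_expKernel_right b (by positivity) t).le

/-- Schur test: the kernel has mass 1/δ in each of its two variables. -/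
lemma lintegral_sq_lintegral_expKernel_le (b : Bool) {δ : ℝ} (hδ : 0 < δ) {f : ℝ → ℝ≥0∞}
    (hf : AEMeasurable f (volume.restrict (Iic 0))) :
    ∫⁻ t in Iic 0, (∫⁻ s in Iic 0, expKernel b δ (t, s) * f s) ^ 2 ≤
      ENNReal.ofReal (1 / δ) ^ 2 * ∫⁻ s in Iic 0, f s ^ 2 := by
  have hsplit : ∀ q, expKernel b δ q = expKernel b (δ / 2) q ^ 2 := fun q => by
    rw [expKernel_mul_self]; congr 1; ring
  have hm : ∀ δ t, Measurable fun s => expKernel b δ (t, s) := fun δ t =>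
    (measurable_expKernel b δ).comp (by fun_prop)
  calc ∫⁻ t in Iic 0, (∫⁻ s in Iic 0, expKernel b δ (t, s) * f s) ^ 2
      ≤ ∫⁻ t in Iic 0, ENNReal.ofReal (1 / δ) *
          ∫⁻ s in Iic 0, expKernel b δ (t, s) * f s ^ 2 := by
        refine lintegral_mono fun t => ?_
        -- Each half-rate kernel is a square root of the kernel. Cauchy–Schwarz on the product of
        -- one of them with the other times f leaves the mass of the kernel and the kernel
        -- integrated against f².
        have h := sq_lintegral_mul_le (μ := volume.restrict (Iic 0)) (hm (δ / 2) t).aemeasurable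
          (((hm (δ / 2) t).aemeasurable).mul hf)
        simp only [Pi.mul_apply, ← mul_assoc, ← sq, mul_pow, ← hsplit] at h
        refine h.trans ?_
        gcongr
        exact (setLIntegral_le_lintegral _ _).trans (lintegral_expKernel_right b hδ t).le
    _ = ENNReal.ofReal (1 / δ) *
          ∫⁻ s in Iic 0, ∫⁻ t in Iic 0, expKernel b δ (t, s) * f s ^ 2 := by
        rw [lintegral_const_mul' _ _ (by finiteness), lintegral_lintegral_swap]
        refine (measurable_expKernel b δ).aemeasurable.mul ?_
        exact (hf.pow_const 2).comp_quasiMeasurePreserving Measure.quasiMeasurePreserving_snd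
    _ ≤ ENNReal.ofReal (1 / δ) * ∫⁻ s in Iic 0, ENNReal.ofReal (1 / δ) * f s ^ 2 := by
        gcongr with s
        have hm' : Measurable fun t => expKernel b δ (t, s) :=
          (measurable_expKernel b δ).comp (by fun_prop)
        rw [lintegral_mul_const _ hm']
        gcongr
        exact (setLIntegral_le_lintegral _ _).trans (lintegral_expKernel_left b hδ s).le
    _ = _ := by
        rw [lintegral_const_mul' _ _ (by finiteness), sq, mul_assoc]

/-! ### Solutions of one mode `u' + l u = h` -/

/-- Green's function of `u' + l u = h` on `ℝ₋`: with `u(0) = 0` if `b = true`, and without growth at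
`-∞` if `b = false`. -/
def greenKernel (b : Bool) (l : ℝ) : ℝ × ℝ → ℝ :=
  (kernelDomain b).indicator fun q => (if b then -1 else 1) * Real.exp (l * (q.2 - q.1))

/-- The solution of `u' + l u = h` on `ℝ₋` given by Green's function. -/
def modeSol (b : Bool) (l : ℝ) (h : ℝ → ℝ) (t : ℝ) : ℝ :=
  ∫ s in Iic 0, greenKernel b l (t, s) * h s

lemma measurable_greenKernel (b : Bool) (l : ℝ) : Measurable (greenKernel b l) :=
  Measurable.indicator (by fun_prop) (measurableSet_kernelDomain b)

/-- The mode with eigenvalue `l` lies at distance `δ` from `θ`, below if `b = true` and above if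
`b = false`. -/
def ModeGap (b : Bool) (l θ δ : ℝ) : Prop := l = if b then θ - δ else θ + δ

/-- The weight shifts the exponent l to l - θ. The sign of l - θ matches the side on which the
Green's function lives, so the conjugated kernel decays away from the diagonal at the rate δ = |l -
θ|. -/
lemma exp_mul_enorm_greenKernel {b : Bool} {l θ δ : ℝ} (hl : ModeGap b l θ δ) (t s : ℝ) :
    ENNReal.ofReal (Real.exp (θ * t)) * ‖greenKernel b l (t, s)‖ₑ =
      expKernel b δ (t, s) * ENNReal.ofReal (Real.exp (θ * s)) := by
  by_cases hq : (t, s) ∈ kernelDomain b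
  · rw [greenKernel, expKernel, indicator_of_mem hq, indicator_of_mem hq, enorm_mul]
    have h1 : ‖(if b then -1 else 1 : ℝ)‖ₑ = 1 := by cases b <;> simp
    rw [h1, one_mul, Real.enorm_eq_ofReal (Real.exp_pos _).le,
      ← ENNReal.ofReal_mul (Real.exp_pos _).le, ← ENNReal.ofReal_mul (Real.exp_pos _).le,
      ← Real.exp_add, ← Real.exp_add]
    congr 2
    cases b
    · simp only [kernelDomain, mem_ofPred_eq, Bool.false_eq_true, if_false] at hq
      simp only [ModeGap, Bool.false_eq_true, if_false] at hl
      simp only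
      rw [abs_of_nonpos (by linarith), hl]; ring
    · simp only [kernelDomain, mem_ofPred_eq, if_true] at hq
      simp only [ModeGap, if_true] at hl
      simp only
      rw [abs_of_pos (by linarith), hl]; ring
  · rw [greenKernel, expKernel, indicator_of_notMem hq, indicator_of_notMem hq]; simp

section Mode

variable {b : Bool} {l θ δ : ℝ} {h : ℝ → ℝ}

lemma exp_mul_lintegral_greenKernel (hl : ModeGap b l θ δ) (h : ℝ → ℝ) (t : ℝ) :
    ENNReal.ofReal (Real.exp (θ * t)) * ∫⁻ s in Iic 0, ‖greenKernel b l (t, s) * h s‖ₑ =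
      ∫⁻ s in Iic 0, expKernel b δ (t, s) * (ENNReal.ofReal (Real.exp (θ * s)) * ‖h s‖ₑ) := by
  rw [← lintegral_const_mul' _ _ (by finiteness)]
  refine lintegral_congr fun s => ?_
  rw [enorm_mul, ← mul_assoc, exp_mul_enorm_greenKernel hl, mul_assoc]

lemma exp_mul_enorm_modeSol_le (hl : ModeGap b l θ δ) (h : ℝ → ℝ) (t : ℝ) :
    ENNReal.ofReal (Real.exp (θ * t)) * ‖modeSol b l h t‖ₑ ≤
      ∫⁻ s in Iic 0, expKernel b δ (t, s) * (ENNReal.ofReal (Real.exp (θ * s)) * ‖h s‖ₑ) := by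
  rw [← exp_mul_lintegral_greenKernel hl]
  gcongr
  exact enorm_integral_le_lintegral_enorm _

lemma aemeasurable_exp_mul_enorm {X : Type*} [NormedAddCommGroup X] {h : ℝ → X}
    (hm : AEStronglyMeasurable h (volume.restrict (Iic 0))) (θ : ℝ) :
    AEMeasurable (fun s => ENNReal.ofReal (Real.exp (θ * s)) * ‖h s‖ₑ)
      (volume.restrict (Iic 0)) :=
  AEMeasurable.mul (by fun_prop) hm.enorm

lemma sq_modeSol_le (hδ : 0 < δ) (hl : ModeGap b l θ δ)
    (hm : AEStronglyMeasurable h (volume.restrict (Iic 0))) (t : ℝ) :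
    (ENNReal.ofReal (Real.exp (θ * t)) * ‖modeSol b l h t‖ₑ) ^ 2 ≤
      ENNReal.ofReal (1 / (2 * δ)) * wsq θ h :=
  (pow_le_pow_left' (exp_mul_enorm_modeSol_le hl h t) 2).trans
    (sq_lintegral_expKernel_le b hδ (aemeasurable_exp_mul_enorm hm θ) t)

lemma wsq_modeSol_le (hδ : 0 < δ) (hl : ModeGap b l θ δ)
    (hm : AEStronglyMeasurable h (volume.restrict (Iic 0))) :
    wsq θ (modeSol b l h) ≤ ENNReal.ofReal (1 / δ) ^ 2 * wsq θ h :=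
  (lintegral_mono fun t => pow_le_pow_left' (exp_mul_enorm_modeSol_le hl h t) 2).trans
    (lintegral_sq_lintegral_expKernel_le b hδ (aemeasurable_exp_mul_enorm hm θ))

lemma integrable_greenKernel_mul (hδ : 0 < δ) (hl : ModeGap b l θ δ)
    (hh : MemLp h 2 (expWeight θ)) (t : ℝ) :
    Integrable (fun s => greenKernel b l (t, s) * h s) (volume.restrict (Iic 0)) := by
  obtain ⟨hm, hfin⟩ := memLp_iff_wsq.1 hh
  have hg : Measurable fun s => greenKernel b l (t, s) :=
    (measurable_greenKernel b l).comp (by fun_prop)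
  refine ⟨hg.aestronglyMeasurable.mul hm, ?_⟩
  have h1 := sq_lintegral_expKernel_le b hδ (aemeasurable_exp_mul_enorm hm θ) t
  rw [← exp_mul_lintegral_greenKernel hl] at h1
  have h2 := h1.trans_lt (ENNReal.mul_lt_top ENNReal.ofReal_lt_top hfin)
  rw [ENNReal.pow_lt_top_iff] at h2
  simp only [OfNat.ofNat_ne_zero, or_false] at h2
  exact ENNReal.lt_top_of_mul_ne_top_right h2.ne (by simpa using Real.exp_pos _)

lemma modeSol_add (hδ : 0 < δ) (hl : ModeGap b l θ δ) {g : ℝ → ℝ}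
    (hh : MemLp h 2 (expWeight θ)) (hg : MemLp g 2 (expWeight θ)) (t : ℝ) :
    modeSol b l (fun s => h s + g s) t = modeSol b l h t + modeSol b l g t := by
  simp only [modeSol, mul_add]
  exact integral_add (integrable_greenKernel_mul hδ hl hh t)
    (integrable_greenKernel_mul hδ hl hg t)

lemma modeSol_const_mul (c : ℝ) (h : ℝ → ℝ) (t : ℝ) :
    modeSol b l (fun s => c * h s) t = c * modeSol b l h t := by
  simp only [modeSol, mul_left_comm _ c, integral_const_mul]

lemma modeSol_congr_ae {g : ℝ → ℝ} (hg : h =ᵐ[volume.restrict (Iic 0)] g) (t : ℝ) :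
    modeSol b l h t = modeSol b l g t :=
  integral_congr_ae (hg.mono fun s hs => by simp only [hs])

/-- Up to sign and support, e^{lt} times the Green's function is e^{ls}, which does not depend on t.
Comparing the times t and 0 leaves only (t, 0], with the same sign for both types of mode. -/
lemma exp_mul_greenKernel_sub (b : Bool) (l : ℝ) {t s : ℝ} (hs : s ≤ 0) (y : ℝ) :
    Real.exp (l * t) * (greenKernel b l (t, s) * y) - greenKernel b l (0, s) * y =
      -(Ioc t 0).indicator (fun s => Real.exp (l * s) * y) s := by
  have he : Real.exp (l * t) * Real.exp (l * (s - t)) = Real.exp (l * s) := by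
    rw [← Real.exp_add]; congr 1; ring
  cases b
  · by_cases hst : s ≤ t
    · simp [greenKernel, kernelDomain, indicator, hs, hst, ← he, mul_assoc]
    · simp [greenKernel, kernelDomain, indicator, hs, hst, lt_of_not_ge hst]
  · by_cases hst : s ≤ t
    · simp [greenKernel, kernelDomain, indicator, hs, hs.not_gt, hst.not_gt]
    · simp [greenKernel, kernelDomain, indicator, hs, hs.not_gt, lt_of_not_ge hst, ← he, mul_assoc]

lemma integrableOn_exp_mul (hδ : 0 < δ) (hl : ModeGap b l θ δ) (hh : MemLp h 2 (expWeight θ))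
    (t : ℝ) : IntegrableOn (fun s => Real.exp (l * s) * h s) (Ioc t 0) := by
  have h1 := ((integrable_greenKernel_mul hδ hl hh t).const_mul (Real.exp (l * t))).sub
    (integrable_greenKernel_mul hδ hl hh 0)
  have h2 : Integrable ((Ioc t 0).indicator (fun s => Real.exp (l * s) * h s))
      (volume.restrict (Iic 0)) := by
    refine h1.neg.congr ((ae_restrict_iff' measurableSet_Iic).2 (ae_of_all _ fun s hs => ?_))
    simp only [Pi.neg_apply, Pi.sub_apply]
    rw [exp_mul_greenKernel_sub b l hs, neg_neg]
    simp [indicator]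
  rw [integrable_indicator_iff measurableSet_Ioc, IntegrableOn,
    Measure.restrict_restrict measurableSet_Ioc,
    inter_eq_left.2 fun x hx => hx.2] at h2
  exact h2

/-- Variation of constants, in one form for both types of mode. The type survives only in the value
at 0, so continuity and the differential equation are proved once. -/
lemma modeSol_eq (hδ : 0 < δ) (hl : ModeGap b l θ δ) (hh : MemLp h 2 (expWeight θ))
    {t : ℝ} (ht : t ≤ 0) :
    modeSol b l h t =
      Real.exp (-l * t) * (modeSol b l h 0 + ∫ s in (0 : ℝ)..t, Real.exp (l * s) * h s) := by
  have h1 : Real.exp (l * t) * modeSol b l h t - modeSol b l h 0 =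
      ∫ s in (0 : ℝ)..t, Real.exp (l * s) * h s := by
    rw [modeSol, modeSol, ← integral_const_mul, ← integral_sub
      ((integrable_greenKernel_mul hδ hl hh t).const_mul (Real.exp (l * t)))
      (integrable_greenKernel_mul hδ hl hh 0), intervalIntegral.integral_of_ge ht,
      ← integral_indicator measurableSet_Ioc, ← integral_indicator measurableSet_Iic,
      ← integral_neg]
    congr 1
    ext s
    by_cases hs : s ≤ 0
    · rw [indicator_of_mem (mem_Iic.2 hs), exp_mul_greenKernel_sub b l hs]
      simp [indicator]
    · simp [hs]
  rw [← h1, add_sub_cancel, ← mul_assoc, ← Real.exp_add]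
  simp

lemma modeSol_true_zero (l : ℝ) (h : ℝ → ℝ) : modeSol true l h 0 = 0 := by
  rw [modeSol, setIntegral_eq_zero_of_forall_eq_zero]
  intro s hs
  simp [greenKernel, kernelDomain, indicator, (mem_Iic.1 hs).not_gt]

lemma continuousOn_modeSol (hδ : 0 < δ) (hl : ModeGap b l θ δ) (hh : MemLp h 2 (expWeight θ)) :
    ContinuousOn (modeSol b l h) (Iic 0) := by
  set g : ℝ → ℝ := (Iic 0).indicator fun s => Real.exp (l * s) * h s with hg
  have hint : ∀ a c, IntervalIntegrable g volume a c := by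
    intro a c
    rw [intervalIntegrable_iff, hg, integrableOn_indicator_iff measurableSet_Iic]
    have h1 := integrableOn_exp_mul hδ hl hh (min a c)
    refine h1.mono_set fun x hx => ⟨?_, hx.1⟩
    exact hx.2.1
  have hc := intervalIntegral.continuous_primitive hint 0
  have h2 : Continuous fun t => Real.exp (-l * t) * (modeSol b l h 0 + ∫ s in (0 : ℝ)..t, g s) := by
    fun_prop
  refine h2.continuousOn.congr fun t ht => ?_
  rw [modeSol_eq hδ hl hh ht]
  congr 2
  refine intervalIntegral.integral_congr fun s hs => ?_
  rw [uIcc_of_ge ht] at hs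
  simp [hg, hs.2]

end Mode

/-- The variation of constants formula solves `u' + l u = h` in integrated form. -/
lemma integrated_ode_of_formula {l c : ℝ} {u h : ℝ → ℝ} (hh : ContinuousOn h (Iic 0))
    (hu : ∀ t ≤ 0, u t = Real.exp (-l * t) * (c + ∫ s in (0 : ℝ)..t, Real.exp (l * s) * h s))
    {s t : ℝ} (hst : s ≤ t) (ht : t ≤ 0) :
    u t - u s + l * ∫ τ in s..t, u τ = ∫ τ in s..t, h τ := by
  have hgc : ContinuousOn (fun s => Real.exp (l * s) * h s) (Iic 0) :=
    (by fun_prop : Continuous fun s => Real.exp (l * s)).continuousOn.mul hh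
  have hd : ∀ x < 0, HasDerivAt u (h x - l * u x) x := by
    intro x hx
    have h1 : HasDerivAt (fun t => ∫ s in (0 : ℝ)..t, Real.exp (l * s) * h s)
        (Real.exp (l * x) * h x) x := by
      refine intervalIntegral.integral_hasDerivAt_right ?_ ?_ ?_
      · refine (hgc.mono ?_).intervalIntegrable
        rw [uIcc_of_ge hx.le]; exact fun y hy => hy.2
      · exact (hgc.mono Iio_subset_Iic_self).stronglyMeasurableAtFilter isOpen_Iio x hx
      · exact hgc.continuousAt (Iic_mem_nhds hx)
    have h2 : HasDerivAt (fun t => Real.exp (-l * t)) (Real.exp (-l * x) * -l) x := by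
      simpa using ((hasDerivAt_id x).const_mul (-l)).exp
    have h3 := h2.mul (h1.const_add c)
    have h4 : u =ᶠ[nhds x] fun t => Real.exp (-l * t) *
        (c + ∫ s in (0 : ℝ)..t, Real.exp (l * s) * h s) :=
      Filter.eventually_of_mem (Iic_mem_nhds hx) fun t ht => hu t ht
    refine (h3.congr_of_eventuallyEq h4).congr_deriv ?_
    have he : Real.exp (-l * x) * Real.exp (l * x) = 1 := by
      rw [← Real.exp_add]; simp
    rw [hu x hx.le]
    linear_combination (h x) * he
  have huc : ContinuousOn u (Iic 0) := by
    -- Freezing `h` at its value at 0 for positive times gives a continuous integrand on all of ℝ;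
    -- nothing changes for t ≤ 0.
    set g : ℝ → ℝ := fun s => Real.exp (l * s) * h (min s 0) with hg
    have hgc' : Continuous g := by
      have : Continuous fun s : ℝ => h (min s 0) :=
        hh.comp_continuous (by fun_prop) fun s => mem_Iic.2 (min_le_right _ _)
      exact (by fun_prop : Continuous fun s => Real.exp (l * s)).mul this
    have hc := intervalIntegral.continuous_primitive
      (fun a b => hgc'.intervalIntegrable (μ := volume) a b) 0
    have h2 : Continuous fun t => Real.exp (-l * t) * (c + ∫ s in (0 : ℝ)..t, g s) := by
      fun_prop
    refine h2.continuousOn.congr fun t ht => ?_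
    rw [hu t ht]
    congr 2
    refine intervalIntegral.integral_congr fun s hs => ?_
    rw [uIcc_of_ge ht] at hs
    simp [hg, hs.2]
  have hsub : Icc s t ⊆ Iic 0 := fun x hx => hx.2.trans ht
  have hui : IntervalIntegrable u volume s t :=
    (huc.mono (by rwa [uIcc_of_le hst])).intervalIntegrable
  have hhi : IntervalIntegrable h volume s t :=
    (hh.mono (by rwa [uIcc_of_le hst])).intervalIntegrable
  have h5 := intervalIntegral.integral_eq_sub_of_hasDerivAt_of_le hst (huc.mono hsub)
    (fun x hx => hd x (hx.2.trans_le ht)) (hhi.sub (hui.const_mul l))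
  rw [intervalIntegral.integral_sub hhi (hui.const_mul l),
    intervalIntegral.integral_const_mul] at h5
  linarith

/-- Solutions of the homogeneous equation of a mode are exponentials. -/
lemma eq_exp_of_integrated_ode {l : ℝ} {z : ℝ → ℝ} (hz : ContinuousOn z (Iic 0))
    (h : ∀ s t : ℝ, s ≤ t → t ≤ 0 → z t - z s + l * ∫ τ in s..t, z τ = 0) {t : ℝ} (ht : t ≤ 0) :
    z t = Real.exp (-l * t) * z 0 := by
  have hd : ∀ x < 0, HasDerivAt z (-l * z x) x := by
    intro x hx
    -- The hypothesis on [t, 0] expresses z as z(0) plus l times its own primitive, so continuity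
    -- already makes z differentiable.
    have h1 : HasDerivAt (fun t => z 0 + l * ∫ s in t..(0 : ℝ), z s) (l * -z x) x := by
      refine ((intervalIntegral.integral_hasDerivAt_left ?_ ?_ ?_).const_mul l).const_add _
      · refine (hz.mono ?_).intervalIntegrable
        rw [uIcc_of_le hx.le]; exact fun y hy => hy.2
      · exact (hz.mono Iio_subset_Iic_self).stronglyMeasurableAtFilter isOpen_Iio x hx
      · exact hz.continuousAt (Iic_mem_nhds hx)
    refine (h1.congr_of_eventuallyEq (Filter.eventually_of_mem (Iic_mem_nhds hx)
      fun y hy => ?_)).congr_deriv (by ring)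
    have := h y 0 hy le_rfl
    simp only
    linarith
  have hc : ContinuousOn (fun s => Real.exp (l * s) * z s) (Icc t 0) :=
    (by fun_prop : Continuous fun s => Real.exp (l * s)).continuousOn.mul
      (hz.mono fun x hx => hx.2)
  have h5 := intervalIntegral.integral_eq_sub_of_hasDerivAt_of_le (f' := fun _ => 0) ht hc
    (fun x hx => ?_) (by simp)
  · simp only [intervalIntegral.integral_zero, mul_zero, Real.exp_zero, one_mul] at h5
    have h6 : z 0 = Real.exp (l * t) * z t := by linarith
    rw [h6, ← mul_assoc, ← Real.exp_add]
    simp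
  · have h2 : HasDerivAt (fun t => Real.exp (l * t)) (Real.exp (l * x) * l) x := by
      simpa using ((hasDerivAt_id x).const_mul l).exp
    exact (h2.mul (hd x hx.2)).congr_deriv (by ring)

/-! ### Coordinates with respect to a Hilbert basis -/

section Coordinates

variable {X : Type*} [NormedAddCommGroup X] [InnerProductSpace ℝ X] (b : HilbertBasis ℕ ℝ X)

lemma continuous_repr_apply (k : ℕ) : Continuous fun x => b.repr x k := by
  simp_rw [b.repr_apply_apply]
  fun_prop

lemma enorm_sq_eq_tsum (x : X) : ‖x‖ₑ ^ 2 = ∑' k, ‖b.repr x k‖ₑ ^ 2 := by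
  have h := lp.hasSum_norm (p := 2) (by norm_num) (b.repr x)
  simp only [ENNReal.toReal_ofNat, Real.rpow_ofNat, b.repr.norm_map] at h
  rw [← ofReal_norm, ← ENNReal.ofReal_pow (norm_nonneg _), ← h.tsum_eq,
    ENNReal.ofReal_tsum_of_nonneg (fun _ => by positivity) h.summable]
  refine tsum_congr fun k => ?_
  rw [ENNReal.ofReal_pow (norm_nonneg _), ofReal_norm]

lemma memℓp_two_of_tsum {f : ℕ → ℝ} (h : ∑' k, ‖f k‖ₑ ^ 2 ≠ ∞) : Memℓp f 2 := by
  refine memℓp_gen ?_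
  simp only [ENNReal.toReal_ofNat, Real.rpow_ofNat]
  have h1 := ENNReal.summable_toReal h
  refine h1.congr fun k => ?_
  simp

open Classical in
/-- The vector with prescribed square summable coordinates (zero otherwise). -/
def ofCoords (f : ℕ → ℝ) : X := if hf : Memℓp f 2 then b.repr.symm ⟨f, hf⟩ else 0

lemma repr_ofCoords {f : ℕ → ℝ} (hf : Memℓp f 2) (k : ℕ) : b.repr (ofCoords b f) k = f k := by
  simp [ofCoords, hf]

lemma ext_repr {x y : X} (h : ∀ k, b.repr x k = b.repr y k) : x = y := by
  apply b.repr.injective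
  ext k
  exact h k

/-- Parseval and Tonelli. Estimates in the weighted spaces thereby reduce to estimates of single
modes. -/
lemma wsq_eq_tsum {θ : ℝ} {f : ℝ → X} (hf : AEStronglyMeasurable f (volume.restrict (Iic 0))) :
    wsq θ f = ∑' k, wsq θ fun t => b.repr (f t) k := by
  simp only [wsq]
  rw [← lintegral_tsum fun k => (aemeasurable_exp_mul_enorm
    ((continuous_repr_apply b k).comp_aestronglyMeasurable hf) θ).pow_const 2]
  refine lintegral_congr fun t => ?_
  simp only [mul_pow]
  rw [enorm_sq_eq_tsum b, ENNReal.tsum_mul_left]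

end Coordinates

namespace EigenSystem

variable {H : Type*} [NormedAddCommGroup H] [InnerProductSpace ℝ H] [CompleteSpace H]
  {A : PosSelfAdjointOp H} (E : EigenSystem A)

/-! ### The Hilbert space `H_0^1` -/

lemma sqrt_eigval_pos (k : ℕ) : 0 < √(E.eigval k) := Real.sqrt_pos.2 (E.eigval_pos k)

lemma norm_sqrtOp (u : E.H1) : ‖E.sqrtOp u‖ = ‖u‖ := by
  have h1 : ⟪u, u⟫ = ⟪E.sqrtOp u, E.sqrtOp u⟫ := rfl
  rw [real_inner_self_eq_norm_sq, real_inner_self_eq_norm_sq] at h1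
  exact ((pow_left_inj₀ (norm_nonneg _) (norm_nonneg _) two_ne_zero).1 h1).symm

/-- Dividing by √λ_k ≥ √λ_1 > 0 preserves square summability. Surjectivity transports completeness
and the Hilbert basis from H to H_0^1. -/
lemma sqrtOp_surjective : Function.Surjective E.sqrtOp := by
  intro y
  have hy : Memℓp (fun k => (√(E.eigval k))⁻¹ * E.basis.repr y k) 2 := by
    have h1 : Memℓp (fun k => (√(E.eigval 0))⁻¹ * E.basis.repr y k) 2 :=
      (lp.memℓp (E.basis.repr y)).const_smul (√(E.eigval 0))⁻¹
    have h2 := h1.summable (by norm_num)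
    refine memℓp_gen (h2.of_nonneg_of_le (fun k => by positivity) fun k => ?_)
    gcongr
    rw [norm_mul, norm_mul, norm_inv, norm_inv, Real.norm_of_nonneg (Real.sqrt_nonneg _),
      Real.norm_of_nonneg (Real.sqrt_nonneg _)]
    have := E.sqrt_eigval_pos 0
    gcongr
    exact E.mono (Nat.zero_le k)
  have hr : ∀ k, E.basis.repr (ofCoords E.basis fun k => (√(E.eigval k))⁻¹ * E.basis.repr y k) k
      = (√(E.eigval k))⁻¹ * E.basis.repr y k := repr_ofCoords E.basis hy
  have hc : ∀ k, √(E.eigval k) * ((√(E.eigval k))⁻¹ * E.basis.repr y k) = E.basis.repr y k :=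
    fun k => mul_inv_cancel_left₀ (E.sqrt_eigval_pos k).ne' _
  refine ⟨(⟨ofCoords E.basis fun k => (√(E.eigval k))⁻¹ * E.basis.repr y k, ?_⟩ : E.sqrtDomain), ?_⟩
  · change Memℓp _ 2
    simp_rw [hr, hc]
    exact lp.memℓp _
  · refine ext_repr E.basis fun k => ?_
    exact (E.repr_sqrtOp _ k).trans ((congrArg _ (hr k)).trans (hc k))

/-- `A^{1/2}` as an isometry of `H_0^1` onto `H`. -/
def sqrtIso : E.H1 ≃ₗᵢ[ℝ] H :=
  LinearIsometryEquiv.ofSurjective ⟨E.sqrtOp, E.norm_sqrtOp⟩ E.sqrtOp_surjective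

instance : CompleteSpace E.H1 :=
  (completeSpace_congr (e := E.sqrtIso.toEquiv) E.sqrtIso.isometry.isUniformEmbedding).2 inferInstance

/-- The orthonormal basis `λ_k^{-1/2} e_k` of `H_0^1`. -/
def h1Basis : HilbertBasis ℕ ℝ E.H1 := .ofRepr (E.sqrtIso.trans E.basis.repr)

lemma h1Basis_repr (u : E.H1) (k : ℕ) :
    E.h1Basis.repr u k = √(E.eigval k) * E.basis.repr (E.incl u) k :=
  E.repr_sqrtOp u k

lemma repr_incl (u : E.H1) (k : ℕ) :
    E.basis.repr (E.incl u) k = (√(E.eigval k))⁻¹ * E.h1Basis.repr u k := by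
  rw [h1Basis_repr, inv_mul_cancel_left₀ (E.sqrt_eigval_pos k).ne']

lemma eigvec_eq (k : ℕ) : E.eigvec k = √(E.eigval k) • E.h1Basis k := by
  refine ext_repr E.h1Basis fun j => ?_
  have h1 : E.incl (E.eigvec k) = E.basis k := rfl
  rw [h1Basis_repr, h1, map_smul, lp.coeFn_smul, Pi.smul_apply, E.basis.repr_self,
    E.h1Basis.repr_self]
  by_cases hj : j = k
  · subst hj; simp
  · simp [lp.single_apply, hj]

lemma norm_incl_le (u : E.H1) : ‖E.incl u‖ ≤ (√(E.eigval 0))⁻¹ * ‖u‖ := by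
  have h0 := E.sqrt_eigval_pos 0
  have h : ‖E.incl u‖ₑ ^ 2 ≤ (ENNReal.ofReal (√(E.eigval 0))⁻¹ * ‖u‖ₑ) ^ 2 := by
    rw [mul_pow, enorm_sq_eq_tsum E.basis, enorm_sq_eq_tsum E.h1Basis, ← ENNReal.tsum_mul_left]
    refine ENNReal.tsum_le_tsum fun k => ?_
    rw [← mul_pow, repr_incl, enorm_mul, Real.enorm_eq_ofReal (by positivity)]
    gcongr
    exact E.mono (Nat.zero_le k)
  rw [ENNReal.pow_le_pow_left_iff two_ne_zero, ← ofReal_norm, ← ofReal_norm,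
    ← ENNReal.ofReal_mul (by positivity), ENNReal.ofReal_le_ofReal_iff (by positivity)] at h
  exact h

@[fun_prop] lemma continuous_incl : Continuous E.incl :=
  (E.incl.mkContinuous _ E.norm_incl_le).continuous

/-! ### The linear problem with a spectral gap -/

/-- The weight `θ` has distance at least `d` to the spectrum, with exactly `N` eigenvalues
below it. -/
structure Dichotomy (N : ℕ) (θ d : ℝ) : Prop where
  d_pos : 0 < d
  theta_pos : 0 < θ
  low : ∀ k < N, E.eigval k + d ≤ θ
  high : θ + d ≤ E.eigval N

/-- The solution of `∂_t v + A v = h` on `ℝ₋` with `P_N v(0) = 0` without growth of `Q_N v` at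
`-∞`. -/
def mild (N : ℕ) (h : ℝ → H) (t : ℝ) : E.H1 :=
  ofCoords E.h1Basis fun k => √(E.eigval k) *
    modeSol (decide (k < N)) (E.eigval k) (fun s => E.basis.repr (h s) k) t

variable {E} {N : ℕ} {θ d : ℝ}

namespace Dichotomy

variable (D : E.Dichotomy N θ d)
include D

lemma modeGap (k : ℕ) : ModeGap (decide (k < N)) (E.eigval k) θ |E.eigval k - θ| := by
  have hd := D.d_pos
  by_cases hk : k < N
  · have := D.low k hk
    simp only [ModeGap, hk, decide_true, if_true]
    rw [abs_of_neg (by linarith)]; ring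
  · have := D.high
    have := E.mono (not_lt.1 hk)
    simp only [ModeGap, hk, decide_false, Bool.false_eq_true, if_false]
    rw [abs_of_pos (by linarith)]; ring

lemma le_dist (k : ℕ) : d ≤ |E.eigval k - θ| := by
  by_cases hk : k < N
  · have := D.low k hk
    exact le_abs.2 (Or.inr (by linarith))
  · have := D.high
    have := E.mono (not_lt.1 hk)
    exact le_abs.2 (Or.inl (by linarith))

lemma dist_pos (k : ℕ) : 0 < |E.eigval k - θ| := D.d_pos.trans_le (D.le_dist k)

/-- The ratio λ/|λ - θ| over the spectrum is at most λ_{N+1}/d, where `E.eigval N` is λ_{N+1}. Below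
θ, bound numerator and denominator separately; above θ, the ratio decreases in λ and the worst case
is λ_{N+1}. -/
lemma eigval_mul_le (k : ℕ) : E.eigval k * d ≤ E.eigval N * |E.eigval k - θ| := by
  have h0 := E.eigval_pos k
  have hN := E.eigval_pos N
  by_cases hk : k < N
  · exact mul_le_mul (E.mono hk.le) (D.le_dist k) D.d_pos.le hN.le
  · have h1 := D.high
    have h2 := E.mono (not_lt.1 hk)
    have h3 := D.theta_pos
    have hd := D.d_pos
    rw [abs_of_pos (by linarith)]
    nlinarith

lemma eigval_div_le (k : ℕ) : E.eigval k * (1 / (2 * |E.eigval k - θ|)) ≤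
    E.eigval N / (2 * d) := by
  have := D.eigval_mul_le k
  have := D.dist_pos k
  have := D.d_pos
  rw [mul_one_div, div_le_div_iff₀ (by positivity) (by positivity)]
  linarith

/-- Squared, this is the bound on λ_k/|λ_k - θ| combined with d ≤ |λ_k - θ|. It produces the factor
√λ_{N+1} in front of L₁ in the gap condition. -/
lemma sqrt_eigval_div_le (k : ℕ) : √(E.eigval k) * (1 / |E.eigval k - θ|) ≤ √(E.eigval N) / d := by
  have h1 := D.eigval_mul_le k
  have h2 := D.dist_pos k
  have hd := D.d_pos
  have hN := E.eigval_pos N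
  rw [mul_one_div, div_le_div_iff₀ (by positivity) (by positivity)]
  refine abs_le_of_sq_le_sq' ?_ (by positivity) |>.2
  rw [mul_pow, mul_pow, Real.sq_sqrt (E.eigval_pos k).le, Real.sq_sqrt hN.le]
  calc E.eigval k * d ^ 2 = E.eigval k * d * d := by ring
    _ ≤ E.eigval N * |E.eigval k - θ| * |E.eigval k - θ| := by
        gcongr
        exact D.le_dist k
    _ = _ := by ring

omit D in
variable (E) in
lemma aestronglyMeasurable_repr {h : ℝ → H} (hm : AEStronglyMeasurable h (volume.restrict (Iic 0)))
    (k : ℕ) : AEStronglyMeasurable (fun s => E.basis.repr (h s) k) (volume.restrict (Iic 0)) :=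
  (continuous_repr_apply E.basis k).comp_aestronglyMeasurable hm

omit D in
lemma memLp_repr {h : ℝ → H} (hh : MemLp h 2 (expWeight θ)) (k : ℕ) :
    MemLp (fun s => E.basis.repr (h s) k) 2 (expWeight θ) := by
  obtain ⟨hm, hf⟩ := memLp_iff_wsq.1 hh
  refine memLp_iff_wsq.2 ⟨aestronglyMeasurable_repr E hm k, ?_⟩
  rw [wsq_eq_tsum E.basis hm] at hf
  exact (ENNReal.le_tsum k).trans_lt hf

lemma mode_sq_le {h : ℝ → H} (hm : AEStronglyMeasurable h (volume.restrict (Iic 0))) (t : ℝ)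
    (k : ℕ) :
    (ENNReal.ofReal (Real.exp (θ * t)) * ‖√(E.eigval k) *
      modeSol (decide (k < N)) (E.eigval k) (fun s => E.basis.repr (h s) k) t‖ₑ) ^ 2 ≤
    ENNReal.ofReal (E.eigval N / (2 * d)) * wsq θ fun s => E.basis.repr (h s) k := by
  have h1 := sq_modeSol_le (D.dist_pos k) (D.modeGap k) (aestronglyMeasurable_repr E hm k) t
  calc _ = ENNReal.ofReal (E.eigval k) * (ENNReal.ofReal (Real.exp (θ * t)) *
        ‖modeSol (decide (k < N)) (E.eigval k) (fun s => E.basis.repr (h s) k) t‖ₑ) ^ 2 := by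
        rw [enorm_mul, Real.enorm_eq_ofReal (Real.sqrt_nonneg _), mul_left_comm, mul_pow,
          ← ENNReal.ofReal_pow (Real.sqrt_nonneg _), Real.sq_sqrt (E.eigval_pos k).le]
    _ ≤ ENNReal.ofReal (E.eigval k) * (ENNReal.ofReal (1 / (2 * |E.eigval k - θ|)) *
          wsq θ fun s => E.basis.repr (h s) k) := by gcongr
    _ ≤ _ := by
        rw [← mul_assoc, ← ENNReal.ofReal_mul (E.eigval_pos k).le]
        gcongr
        exact D.eigval_div_le k

/-- The right side does not depend on t and is a tail of a convergent series, so the weighted mode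
expansion converges uniformly in time. -/
lemma tsum_compl_mode_sq_le {h : ℝ → H} (hm : AEStronglyMeasurable h (volume.restrict (Iic 0)))
    (t : ℝ) (s : Finset ℕ) :
    ENNReal.ofReal (Real.exp (θ * t)) ^ 2 * ∑' k : {k // k ∉ s}, ‖√(E.eigval k) *
      modeSol (decide ((k : ℕ) < N)) (E.eigval k) (fun s => E.basis.repr (h s) k) t‖ₑ ^ 2 ≤
    ENNReal.ofReal (E.eigval N / (2 * d)) *
      ∑' k : {k // k ∉ s}, wsq θ fun s => E.basis.repr (h s) k := by
  rw [← ENNReal.tsum_mul_left, ← ENNReal.tsum_mul_left]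
  refine ENNReal.tsum_le_tsum fun k => ?_
  rw [← mul_pow]
  exact D.mode_sq_le hm t k

lemma memℓp_mild {h : ℝ → H} (hh : MemLp h 2 (expWeight θ)) (t : ℝ) :
    Memℓp (fun k => √(E.eigval k) *
      modeSol (decide (k < N)) (E.eigval k) (fun s => E.basis.repr (h s) k) t) 2 := by
  obtain ⟨hm, hf⟩ := memLp_iff_wsq.1 hh
  refine memℓp_two_of_tsum (ENNReal.lt_top_of_mul_ne_top_right
    (a := ENNReal.ofReal (Real.exp (θ * t)) ^ 2) (LT.lt.ne (lt_of_le_of_lt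
      (b := ENNReal.ofReal (E.eigval N / (2 * d)) * wsq θ h) ?_
      (ENNReal.mul_lt_top ENNReal.ofReal_lt_top hf))) ?_).ne
  · rw [wsq_eq_tsum E.basis hm, ← ENNReal.tsum_mul_left, ← ENNReal.tsum_mul_left]
    refine ENNReal.tsum_le_tsum fun k => ?_
    rw [← mul_pow]
    exact D.mode_sq_le hm t k
  · simpa using Real.exp_pos _

lemma repr_mild {h : ℝ → H} (hh : MemLp h 2 (expWeight θ)) (t : ℝ) (k : ℕ) :
    E.h1Basis.repr (E.mild N h t) k = √(E.eigval k) *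
      modeSol (decide (k < N)) (E.eigval k) (fun s => E.basis.repr (h s) k) t :=
  repr_ofCoords E.h1Basis (D.memℓp_mild hh t) k

lemma exp_mul_enorm_mild_le {h : ℝ → H} (hh : MemLp h 2 (expWeight θ)) (t : ℝ) :
    (ENNReal.ofReal (Real.exp (θ * t)) * ‖E.mild N h t‖ₑ) ^ 2 ≤
      ENNReal.ofReal (E.eigval N / (2 * d)) * wsq θ h := by
  obtain ⟨hm, hf⟩ := memLp_iff_wsq.1 hh
  rw [mul_pow, enorm_sq_eq_tsum E.h1Basis, wsq_eq_tsum E.basis hm, ← ENNReal.tsum_mul_left,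
    ← ENNReal.tsum_mul_left]
  refine ENNReal.tsum_le_tsum fun k => ?_
  rw [← mul_pow, D.repr_mild hh]
  exact D.mode_sq_le hm t k

lemma mild_add {f g : ℝ → H} (hf : MemLp f 2 (expWeight θ)) (hg : MemLp g 2 (expWeight θ))
    (t : ℝ) : E.mild N (fun s => f s + g s) t = E.mild N f t + E.mild N g t := by
  refine ext_repr E.h1Basis fun k => ?_
  have hfg : MemLp (fun s => f s + g s) 2 (expWeight θ) := hf.add hg
  rw [map_add, lp.coeFn_add, Pi.add_apply, D.repr_mild hfg, D.repr_mild hf, D.repr_mild hg,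
    ← mul_add, ← modeSol_add (D.dist_pos k) (D.modeGap k) (memLp_repr hf k) (memLp_repr hg k)]
  simp only [map_add, lp.coeFn_add, Pi.add_apply]

lemma mild_smul {f : ℝ → H} (hf : MemLp f 2 (expWeight θ)) (c : ℝ)
    (t : ℝ) : E.mild N (fun s => c • f s) t = c • E.mild N f t := by
  refine ext_repr E.h1Basis fun k => ?_
  have hcf : MemLp (fun s => c • f s) 2 (expWeight θ) := hf.const_smul c
  rw [map_smul, lp.coeFn_smul, Pi.smul_apply, D.repr_mild hcf, D.repr_mild hf,
    smul_eq_mul, mul_left_comm]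
  simp only [map_smul, lp.coeFn_smul, Pi.smul_apply, smul_eq_mul, modeSol_const_mul]

lemma mild_sub {f g : ℝ → H} (hf : MemLp f 2 (expWeight θ)) (hg : MemLp g 2 (expWeight θ))
    (t : ℝ) : E.mild N (fun s => f s - g s) t = E.mild N f t - E.mild N g t := by
  have hcg : MemLp (fun s => (-1 : ℝ) • g s) 2 (expWeight θ) := hg.const_smul (-1 : ℝ)
  have h := D.mild_add hf hcg t
  rw [D.mild_smul hg] at h
  simpa [sub_eq_add_neg] using h

omit D in
lemma mild_congr_ae {f g : ℝ → H} (h : f =ᵐ[volume.restrict (Iic 0)] g) (t : ℝ) :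
    E.mild N f t = E.mild N g t := by
  unfold mild
  congr 1
  ext k
  rw [modeSol_congr_ae (g := fun s => E.basis.repr (g s) k) (h.mono fun s hs => by simp only [hs])]

lemma continuousOn_mild {h : ℝ → H} (hh : MemLp h 2 (expWeight θ)) :
    ContinuousOn (E.mild N h) (Iic 0) := by
  obtain ⟨hm, hf⟩ := memLp_iff_wsq.1 hh
  -- The tail estimate is uniform on ℝ₋ only after multiplication by e^{θt}; this factor is
  -- continuous and invertible, hence harmless.
  suffices hc : ContinuousOn (fun t => Real.exp (θ * t) • E.mild N h t) (Iic 0) by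
    have h1 : ContinuousOn (fun t => Real.exp (-(θ * t)) • Real.exp (θ * t) • E.mild N h t)
        (Iic 0) :=
      (by fun_prop : Continuous fun t => Real.exp (-(θ * t))).continuousOn.smul hc
    refine h1.congr fun t _ => ?_
    simp only
    rw [smul_smul, ← Real.exp_add]
    simp
  have hlim := ENNReal.tendsto_tsum_compl_atTop_zero
    ((wsq_eq_tsum E.basis hm (θ := θ)).symm.trans_lt hf).ne
  have hlim2 : Filter.Tendsto (fun s : Finset ℕ => ENNReal.ofReal (E.eigval N / (2 * d)) *
      ∑' k : {k // k ∉ s}, wsq θ fun s => E.basis.repr (h s) k) Filter.atTop (nhds 0) := by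
    simpa using ENNReal.Tendsto.const_mul hlim (Or.inr ENNReal.ofReal_ne_top)
  refine TendstoUniformlyOn.continuousOn (p := Filter.atTop) (F := fun (s : Finset ℕ) t =>
    Real.exp (θ * t) • ∑ k ∈ s, E.h1Basis.repr (E.mild N h t) k • E.h1Basis k) ?_ ?_
  · rw [EMetric.tendstoUniformlyOn_iff]
    intro ε hε
    have hε2 : 0 < ε ^ 2 := by positivity
    filter_upwards [hlim2.eventually_lt_const hε2] with s hs t ht
    rw [edist_eq_enorm_sub, ← smul_sub, enorm_smul, Real.enorm_eq_ofReal (Real.exp_pos _).le]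
    rw [← ENNReal.pow_lt_pow_left_iff two_ne_zero]
    refine lt_of_le_of_lt ?_ hs
    refine le_trans (le_of_eq ?_) (D.tsum_compl_mode_sq_le hm t s)
    rw [mul_pow, enorm_sq_eq_tsum E.h1Basis]
    congr 1
    refine Eq.trans ?_ (tsum_subtype {k | k ∉ s} (fun k => ‖√(E.eigval k) *
      modeSol (decide (k < N)) (E.eigval k) (fun s => E.basis.repr (h s) k) t‖ₑ ^ 2)).symm
    refine tsum_congr fun k => ?_
    rw [map_sub, lp.coeFn_sub, Pi.sub_apply, map_sum, lp.coeFn_sum, Finset.sum_apply]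
    simp only [map_smul, lp.coeFn_smul, Pi.smul_apply, E.h1Basis.repr_self]
    by_cases hk : k ∈ s
    · rw [Finset.sum_eq_single k (fun j _ hj => by simp [lp.single_apply, hj.symm])
        (fun h => absurd hk h)]
      simp [hk, indicator]
    · rw [Finset.sum_eq_zero fun j hj => by
        have : k ≠ j := fun h => hk (h ▸ hj)
        simp [lp.single_apply, this]]
      simp [hk, indicator, D.repr_mild hh]
  · refine Filter.Frequently.of_forall fun s => ?_
    refine (by fun_prop : Continuous fun t => Real.exp (θ * t)).continuousOn.smul (continuousOn_finsetSum _ fun k _ => ?_)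
    simp_rw [D.repr_mild hh]
    exact (continuousOn_const.mul (continuousOn_modeSol (D.dist_pos k) (D.modeGap k)
      (memLp_repr hh k))).smul continuousOn_const

lemma aestronglyMeasurable_mild {h : ℝ → H} (hh : MemLp h 2 (expWeight θ)) :
    AEStronglyMeasurable (E.mild N h) (volume.restrict (Iic 0)) :=
  (D.continuousOn_mild hh).aestronglyMeasurable measurableSet_Iic

lemma wsq_mild_le {h : ℝ → H} (hh : MemLp h 2 (expWeight θ)) :
    wsq θ (E.mild N h) ≤ ∑' k, ENNReal.ofReal (√(E.eigval k) * (1 / |E.eigval k - θ|)) ^ 2 *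
      wsq θ fun s => E.basis.repr (h s) k := by
  obtain ⟨hm, hf⟩ := memLp_iff_wsq.1 hh
  rw [wsq_eq_tsum E.h1Basis (D.aestronglyMeasurable_mild hh)]
  refine ENNReal.tsum_le_tsum fun k => ?_
  have h1 := wsq_modeSol_le (D.dist_pos k) (D.modeGap k) (aestronglyMeasurable_repr E hm k)
  rw [ENNReal.ofReal_mul (Real.sqrt_nonneg _), mul_pow, mul_assoc]
  refine le_trans ?_ (mul_le_mul_right h1 _)
  refine (wsq_le_of_forall (c := √(E.eigval k)) (Real.sqrt_nonneg _) fun t ht => ?_)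
  rw [D.repr_mild hh, norm_mul, Real.norm_of_nonneg (Real.sqrt_nonneg _)]
  exact (mul_left_comm _ _ _).le

lemma eLpNorm_mild_le {h : ℝ → H} (hh : MemLp h 2 (expWeight θ)) :
    eLpNorm (E.mild N h) 2 (expWeight θ) ≤
      ENNReal.ofReal (√(E.eigval N) / d) * eLpNorm h 2 (expWeight θ) := by
  refine eLpNorm_le_of_wsq_le ((D.wsq_mild_le hh).trans ?_)
  rw [wsq_eq_tsum E.basis (memLp_iff_wsq.1 hh).1, ← ENNReal.tsum_mul_left]
  refine ENNReal.tsum_le_tsum fun k => ?_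
  gcongr
  exact D.sqrt_eigval_div_le k

omit D in
lemma memLp_incl {g : ℝ → E.H1} (hg : MemLp g 2 (expWeight θ)) :
    MemLp (fun t => E.incl (g t)) 2 (expWeight θ) :=
  hg.of_le_mul (E.continuous_incl.comp_aestronglyMeasurable hg.1)
    (ae_of_all _ fun t => E.norm_incl_le (g t))

/-- The factor √λ_k from H to H_0^1 is cancelled by the factor λ_k^{-1/2} of the embedding, so no
λ_{N+1} appears. This is why L₂ stands alone in the gap condition. -/
lemma eLpNorm_mild_incl_le {g : ℝ → E.H1} (hg : MemLp g 2 (expWeight θ)) :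
    eLpNorm (E.mild N fun t => E.incl (g t)) 2 (expWeight θ) ≤
      ENNReal.ofReal (1 / d) * eLpNorm g 2 (expWeight θ) := by
  refine eLpNorm_le_of_wsq_le ((D.wsq_mild_le (memLp_incl hg)).trans ?_)
  rw [wsq_eq_tsum E.h1Basis (memLp_iff_wsq.1 hg).1, ← ENNReal.tsum_mul_left]
  refine ENNReal.tsum_le_tsum fun k => ?_
  have hd := D.d_pos
  have hs := E.sqrt_eigval_pos k
  calc _ ≤ ENNReal.ofReal (√(E.eigval k) * (1 / |E.eigval k - θ|)) ^ 2 *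
        (ENNReal.ofReal (√(E.eigval k))⁻¹ ^ 2 * wsq θ fun s => E.h1Basis.repr (g s) k) := by
        gcongr
        refine wsq_le_of_forall (by positivity) fun t ht => ?_
        rw [repr_incl, norm_mul, Real.norm_of_nonneg (by positivity)]
        exact (mul_left_comm _ _ _).le
    _ = ENNReal.ofReal (1 / |E.eigval k - θ|) ^ 2 * wsq θ fun s => E.h1Basis.repr (g s) k := by
        rw [← mul_assoc, ← mul_pow, ← ENNReal.ofReal_mul (by positivity)]
        congr 3
        field_simp
    _ ≤ _ := by
        gcongr
        exact D.le_dist k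

lemma memLp_mild {h : ℝ → H} (hh : MemLp h 2 (expWeight θ)) :
    MemLp (E.mild N h) 2 (expWeight θ) :=
  ⟨aestronglyMeasurable_expWeight_iff.2 (D.aestronglyMeasurable_mild hh),
    (D.eLpNorm_mild_le hh).trans_lt (ENNReal.mul_lt_top ENNReal.ofReal_lt_top hh.2)⟩

/-- A pointwise bound from an L² bound. It controls the factor raised to the power ε in the Hölder
estimates, where an L² bound alone would not suffice. -/
lemma exp_mul_norm_mild_le {h : ℝ → H} (hh : MemLp h 2 (expWeight θ)) (t : ℝ) :
    Real.exp (θ * t) * ‖E.mild N h t‖ ≤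
      √(E.eigval N / (2 * d)) * (eLpNorm h 2 (expWeight θ)).toReal := by
  have h1 := D.exp_mul_enorm_mild_le hh t
  have hN := E.eigval_pos N
  have hd := D.d_pos
  rw [← eLpNorm_sq, ← Real.sq_sqrt (by positivity : 0 ≤ E.eigval N / (2 * d)),
    ENNReal.ofReal_pow (Real.sqrt_nonneg _), ← mul_pow, ENNReal.pow_le_pow_left_iff two_ne_zero,
    ← ENNReal.ofReal_toReal hh.2.ne, ← ENNReal.ofReal_mul (Real.sqrt_nonneg _), ← ofReal_norm,
    ← ENNReal.ofReal_mul (Real.exp_pos _).le, ENNReal.ofReal_le_ofReal_iff (by positivity)] at h1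
  exact h1

end Dichotomy

end EigenSystem

/-! ### Constants in the weighted spaces and real-valued weighted norms -/

lemma isFiniteMeasure_expWeight {d : ℝ} (hd : 0 < d) : IsFiniteMeasure (expWeight d) := by
  refine ⟨?_⟩
  have h := lintegral_expWeight d fun _ => 1
  simp only [lintegral_one, mul_one] at h
  rw [h, ← ofReal_integral_eq_lintegral_ofReal
    (integrableOn_exp_mul_Iic (by positivity : 0 < 2 * d) _)
    (ae_of_all _ fun _ => (Real.exp_pos _).le)]
  exact ENNReal.ofReal_lt_top

/-- For a positive weight the values F₁(0) and F₂(0) are admissible forcings, so the nonlinearities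
need not vanish at 0. -/
lemma memLp_const_expWeight {X : Type*} [NormedAddCommGroup X] {d : ℝ} (hd : 0 < d) (c : X) :
    MemLp (fun _ : ℝ => c) 2 (expWeight d) :=
  have := isFiniteMeasure_expWeight hd
  memLp_const c

/-- The norm of `L²_θ(ℝ₋, X)` of a function, as a real number. -/
def wnorm {X : Type*} [NormedAddCommGroup X] (θ : ℝ) (f : ℝ → X) : ℝ :=
  (eLpNorm f 2 (expWeight θ)).toReal

section Wnorm

variable {X Y : Type*} [NormedAddCommGroup X] [NormedAddCommGroup Y] {θ θ' : ℝ}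

lemma wnorm_nonneg (θ : ℝ) (f : ℝ → X) : 0 ≤ wnorm θ f := ENNReal.toReal_nonneg

lemma ofReal_wnorm {f : ℝ → X} (hf : MemLp f 2 (expWeight θ)) :
    ENNReal.ofReal (wnorm θ f) = eLpNorm f 2 (expWeight θ) := ENNReal.ofReal_toReal hf.2.ne

lemma wnorm_le_mul {f : ℝ → X} {g : ℝ → Y} {c : ℝ} (hc : 0 ≤ c) (hg : MemLp g 2 (expWeight θ'))
    (h : eLpNorm f 2 (expWeight θ) ≤ ENNReal.ofReal c * eLpNorm g 2 (expWeight θ')) :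
    wnorm θ f ≤ c * wnorm θ' g := by
  have h1 := ENNReal.toReal_mono (ENNReal.mul_ne_top ENNReal.ofReal_ne_top hg.2.ne) h
  rwa [ENNReal.toReal_mul, ENNReal.toReal_ofReal hc] at h1

lemma wnorm_le_of_forall {f : ℝ → X} {g : ℝ → Y} {c : ℝ} (hc : 0 ≤ c)
    (hg : MemLp g 2 (expWeight θ'))
    (h : ∀ t ≤ 0, Real.exp (θ * t) * ‖f t‖ ≤ c * (Real.exp (θ' * t) * ‖g t‖)) :
    wnorm θ f ≤ c * wnorm θ' g :=
  wnorm_le_mul hc hg (eLpNorm_expWeight_le hc h)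

lemma wnorm_add_le {f g : ℝ → X} (hf : MemLp f 2 (expWeight θ)) (hg : MemLp g 2 (expWeight θ)) :
    wnorm θ (fun t => f t + g t) ≤ wnorm θ f + wnorm θ g := by
  have h := eLpNorm_add_le hf.1 hg.1 (by norm_num : (1 : ℝ≥0∞) ≤ 2)
  have h1 := ENNReal.toReal_mono (ENNReal.add_ne_top.2 ⟨hf.2.ne, hg.2.ne⟩) h
  rwa [ENNReal.toReal_add hf.2.ne hg.2.ne] at h1

lemma wnorm_congr {f g : ℝ → X} (h : ∀ t ≤ 0, f t = g t) : wnorm θ f = wnorm θ g := by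
  rw [wnorm, eLpNorm_congr_ae (ae_expWeight_of_forall h), wnorm]

end Wnorm

namespace EigenSystem

variable {H : Type*} [NormedAddCommGroup H] [InnerProductSpace ℝ H] [CompleteSpace H]
  {A : PosSelfAdjointOp H} {E : EigenSystem A} {N : ℕ} {θ d : ℝ}

/-! ### The finite dimensional part -/

lemma h1Basis_mem_PN {k : ℕ} (hk : k < N) : E.h1Basis k ∈ E.PN N := by
  have h : E.eigvec k ∈ E.PN N := Submodule.subset_span ⟨⟨k, hk⟩, rfl⟩
  rw [eigvec_eq] at h
  exact (Submodule.smul_mem_iff _ (E.sqrt_eigval_pos k).ne').1 h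

lemma mem_PN_orthogonal_iff {x : E.H1} :
    x ∈ (E.PN N)ᗮ ↔ ∀ k < N, E.h1Basis.repr x k = 0 := by
  constructor
  · intro hx k hk
    rw [E.h1Basis.repr_apply_apply]
    exact (Submodule.mem_orthogonal _ _).1 hx _ (h1Basis_mem_PN hk)
  · intro hx
    rw [Submodule.mem_orthogonal]
    intro u hu
    induction hu using Submodule.span_induction with
    | mem y hy =>
      obtain ⟨k, rfl⟩ := hy
      simp only
      rw [eigvec_eq, real_inner_smul_left, ← E.h1Basis.repr_apply_apply, hx k k.2, mul_zero]
    | zero => simp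
    | add y z _ _ hy hz => rw [inner_add_left, hy, hz, add_zero]
    | smul c y _ hy => rw [real_inner_smul_left, hy, mul_zero]

lemma repr_PN_eq_zero (p : E.PN N) {k : ℕ} (hk : N ≤ k) : E.h1Basis.repr (p : E.H1) k = 0 := by
  have h : E.h1Basis k ∈ (E.PN N)ᗮ := by
    rw [mem_PN_orthogonal_iff]
    intro j hj
    rw [E.h1Basis.repr_self]
    have : j ≠ k := by omega
    simp [lp.single_apply, this]
  rw [E.h1Basis.repr_apply_apply, real_inner_comm]
  exact (Submodule.mem_orthogonal _ _).1 h _ p.2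

lemma orthogonalProjectionOnto_eq_iff {x : E.H1} {p : E.PN N} :
    (E.PN N).orthogonalProjectionOnto x = p ↔
      ∀ k < N, E.h1Basis.repr x k = E.h1Basis.repr (p : E.H1) k := by
  have h1 : x - (p : E.H1) ∈ (E.PN N)ᗮ ↔
      ∀ k < N, E.h1Basis.repr x k = E.h1Basis.repr (p : E.H1) k := by
    rw [mem_PN_orthogonal_iff]
    simp only [map_sub, lp.coeFn_sub, Pi.sub_apply, sub_eq_zero]
  rw [← h1]
  constructor
  · rintro rfl
    exact Submodule.sub_starProjection_mem_orthogonal x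
  · intro h
    exact Subtype.ext (Submodule.eq_starProjection_of_mem_orthogonal p.2 h)

/-- The solution `e^{-At} p` of the homogeneous equation, for `p ∈ P_N(H_0^1)`. -/
def free (p : E.PN N) (t : ℝ) : E.H1 :=
  ∑ k ∈ Finset.range N,
    (Real.exp (-E.eigval k * t) * E.h1Basis.repr (p : E.H1) k) • E.h1Basis k

lemma repr_free (p : E.PN N) (t : ℝ) (k : ℕ) :
    E.h1Basis.repr (free p t) k =
      Real.exp (-E.eigval k * t) * E.h1Basis.repr (p : E.H1) k := by
  rw [free, map_sum, lp.coeFn_sum, Finset.sum_apply]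
  simp only [map_smul, lp.coeFn_smul, Pi.smul_apply, E.h1Basis.repr_self]
  by_cases hk : k < N
  · rw [Finset.sum_eq_single k (fun j _ hj => by simp [lp.single_apply, hj.symm])
      (fun h => absurd (Finset.mem_range.2 hk) h)]
    simp
  · rw [repr_PN_eq_zero p (not_lt.1 hk), mul_zero]
    refine Finset.sum_eq_zero fun j hj => ?_
    have : k ≠ j := fun h => hk (h ▸ Finset.mem_range.1 hj)
    simp [lp.single_apply, this]

lemma free_add (p q : E.PN N) (t : ℝ) : free (p + q) t = free p t + free q t := by
  refine ext_repr E.h1Basis fun k => ?_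
  rw [map_add, lp.coeFn_add, Pi.add_apply]
  simp only [repr_free, Submodule.coe_add, map_add, lp.coeFn_add, Pi.add_apply, mul_add]

lemma free_smul (c : ℝ) (p : E.PN N) (t : ℝ) : free (c • p) t = c • free p t := by
  refine ext_repr E.h1Basis fun k => ?_
  rw [map_smul, lp.coeFn_smul, Pi.smul_apply]
  simp only [repr_free, Submodule.coe_smul, map_smul, lp.coeFn_smul, Pi.smul_apply, smul_eq_mul]
  ring

lemma free_sub (p q : E.PN N) (t : ℝ) : free (p - q) t = free p t - free q t := by
  have h := free_add p ((-1 : ℝ) • q) t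
  rw [free_smul] at h
  simpa [sub_eq_add_neg] using h

lemma continuous_free (p : E.PN N) : Continuous (free p) := by
  unfold free
  fun_prop

namespace Dichotomy

variable (D : E.Dichotomy N θ d)
include D

/-- Only modes with λ_k ≤ θ - d occur, so for t ≤ 0 each factor e^{(θ - λ_k)t} is at most e^{dt}.
The constant N is the crude bound from summing N modes. -/
lemma exp_mul_norm_free_le (p : E.PN N) {t : ℝ} (ht : t ≤ 0) :
    Real.exp (θ * t) * ‖free p t‖ ≤ N * ‖p‖ * Real.exp (d * t) := by
  have h1 : ‖free p t‖ ≤ ∑ k ∈ Finset.range N, Real.exp (-E.eigval k * t) * ‖p‖ := by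
    refine norm_sum_le_of_le _ fun k _ => ?_
    rw [norm_smul, E.h1Basis.orthonormal.1 k, mul_one, norm_mul,
      Real.norm_of_nonneg (Real.exp_pos _).le]
    gcongr
    rw [E.h1Basis.repr_apply_apply]
    refine (norm_inner_le_norm _ _).trans ?_
    rw [E.h1Basis.orthonormal.1 k, one_mul, Submodule.coe_norm]
  calc Real.exp (θ * t) * ‖free p t‖
      ≤ Real.exp (θ * t) * ∑ k ∈ Finset.range N, Real.exp (-E.eigval k * t) * ‖p‖ := by gcongr
    _ = ∑ k ∈ Finset.range N, Real.exp (θ * t + -E.eigval k * t) * ‖p‖ := by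
        rw [Finset.mul_sum]
        refine Finset.sum_congr rfl fun k _ => ?_
        rw [Real.exp_add, mul_assoc]
    _ ≤ ∑ k ∈ Finset.range N, Real.exp (d * t) * ‖p‖ := by
        refine Finset.sum_le_sum fun k hk => ?_
        gcongr
        have := D.low k (Finset.mem_range.1 hk)
        nlinarith
    _ = _ := by
        rw [Finset.sum_const, Finset.card_range, nsmul_eq_mul]; ring

lemma memLp_free (p : E.PN N) : MemLp (free p) 2 (expWeight θ) := by
  refine memLp_of_forall (c := N * ‖p‖) (by positivity)
    (continuous_free p).aestronglyMeasurable (memLp_const_expWeight D.d_pos (1 : ℝ)) fun t ht => ?_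
  simpa using D.exp_mul_norm_free_le p ht

lemma wnorm_free_le (p : E.PN N) :
    wnorm θ (free p) ≤ N * ‖p‖ * wnorm d (fun _ => (1 : ℝ)) := by
  refine wnorm_le_of_forall (by positivity) (memLp_const_expWeight D.d_pos (1 : ℝ)) fun t ht => ?_
  simpa using D.exp_mul_norm_free_le p ht

/-! ### The integral equation -/

/-- The constant (√λ_{N+1} L₁ + L₂)/d is the contraction factor. It serves both for differences of
solutions and for linearized terms, which is why the hypotheses ask only for pointwise domination by
z. -/
lemma eLpNorm_mild_add_incl_le {L₁ L₂ : ℝ≥0} {h₁ : ℝ → H} {h₂ z : ℝ → E.H1}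
    (hh₁ : MemLp h₁ 2 (expWeight θ)) (hh₂ : MemLp h₂ 2 (expWeight θ))
    (hz₁ : ∀ t ≤ 0, ‖h₁ t‖ ≤ L₁ * ‖z t‖) (hz₂ : ∀ t ≤ 0, ‖h₂ t‖ ≤ L₂ * ‖z t‖) :
    eLpNorm (E.mild N fun t => h₁ t + E.incl (h₂ t)) 2 (expWeight θ) ≤
      ENNReal.ofReal ((√(E.eigval N) * L₁ + L₂) / d) * eLpNorm z 2 (expWeight θ) := by
  have hd := D.d_pos
  have key : ∀ {X : Type _} [NormedAddCommGroup X] {f : ℝ → X} {L : ℝ≥0},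
      (∀ t ≤ 0, ‖f t‖ ≤ L * ‖z t‖) →
      eLpNorm f 2 (expWeight θ) ≤ ENNReal.ofReal L * eLpNorm z 2 (expWeight θ) := by
    intro X _ f L hf
    refine eLpNorm_expWeight_le L.2 fun t ht => ?_
    rw [mul_left_comm]
    gcongr
    exact hf t ht
  have h1 : E.mild N (fun t => h₁ t + E.incl (h₂ t)) =
      E.mild N h₁ + E.mild N fun t => E.incl (h₂ t) := by
    funext t
    exact D.mild_add hh₁ (memLp_incl hh₂) t
  rw [h1]
  refine (eLpNorm_add_le (D.memLp_mild hh₁).1 (D.memLp_mild (memLp_incl hh₂)).1 (by norm_num)).trans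
    ((add_le_add ((D.eLpNorm_mild_le hh₁).trans (mul_le_mul_right (key hz₁) _))
      ((D.eLpNorm_mild_incl_le hh₂).trans (mul_le_mul_right (key hz₂) _))).trans_eq ?_)
  rw [← mul_assoc, ← mul_assoc, ← add_mul, ← ENNReal.ofReal_mul (by positivity),
    ← ENNReal.ofReal_mul (by positivity), ← ENNReal.ofReal_add (by positivity) (by positivity)]
  congr 2
  ring

/-- A priori estimate for the integral equation with a subcritical linear term. -/
theorem exists_apriori {L₁ L₂ : ℝ≥0} (hL : √(E.eigval N) * L₁ + L₂ < d) :
    ∃ C : ℝ, 0 ≤ C ∧ ∀ {z h₂ : ℝ → E.H1} {h₁ r : ℝ → H} {ξ : E.PN N},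
      MemLp z 2 (expWeight θ) → MemLp h₁ 2 (expWeight θ) → MemLp h₂ 2 (expWeight θ) →
      MemLp r 2 (expWeight θ) →
      (∀ t ≤ 0, ‖h₁ t‖ ≤ L₁ * ‖z t‖) → (∀ t ≤ 0, ‖h₂ t‖ ≤ L₂ * ‖z t‖) →
      (∀ t ≤ 0, z t = E.mild N (fun s => h₁ s + E.incl (h₂ s) + r s) t + free ξ t) →
      wnorm θ z ≤ C * (wnorm θ r + ‖ξ‖) ∧
        ∀ t ≤ 0, Real.exp (θ * t) * ‖z t‖ ≤ C * (wnorm θ r + ‖ξ‖) := by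
  have hd := D.d_pos
  have hΛ := E.eigval_pos N
  have hl0 := E.sqrt_eigval_pos 0
  set q : ℝ := (√(E.eigval N) * L₁ + L₂) / d with hq
  have hq1 : q < 1 := (div_lt_one hd).2 hL
  have hq0 : 0 ≤ q := by positivity
  set K : ℝ := wnorm d (fun _ => (1 : ℝ)) with hK
  have hK0 : 0 ≤ K := wnorm_nonneg _ _
  set c : ℝ := √(E.eigval N / (2 * d)) with hc
  set i : ℝ := (√(E.eigval 0))⁻¹ with hi
  -- The L² bound: the term q‖z‖ is absorbed into the left side, which costs the factor 1/(1 - q).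
  set C₁ : ℝ := (√(E.eigval N) / d + N * K) / (1 - q) with hC₁
  have hq2 : 0 < 1 - q := by linarith
  have hC₁0 : 0 ≤ C₁ := by positivity
  -- The pointwise bound: the equation is read once more at a fixed time, with the L² bound inserted
  -- into its right side.
  set C₂ : ℝ := c * ((L₁ + i * L₂) * C₁ + 1) + N with hC₂
  have hC₂0 : 0 ≤ C₂ := by positivity
  refine ⟨C₁ + C₂, by positivity, ?_⟩
  intro z h₂ h₁ r ξ hz hh₁ hh₂ hr hz₁ hz₂ heq
  have hr0 := wnorm_nonneg θ r
  have hz0 := wnorm_nonneg θ z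
  have hh : MemLp (fun s => h₁ s + E.incl (h₂ s)) 2 (expWeight θ) := hh₁.add (memLp_incl hh₂)
  have hhr : MemLp (fun s => h₁ s + E.incl (h₂ s) + r s) 2 (expWeight θ) := hh.add hr
  have hw1 : wnorm θ (E.mild N fun s => h₁ s + E.incl (h₂ s)) ≤ q * wnorm θ z :=
    wnorm_le_mul hq0 hz (D.eLpNorm_mild_add_incl_le hh₁ hh₂ hz₁ hz₂)
  have hw2 : wnorm θ (E.mild N r) ≤ √(E.eigval N) / d * wnorm θ r :=
    wnorm_le_mul (by positivity) hr (D.eLpNorm_mild_le hr)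
  have hw3 : wnorm θ (free ξ) ≤ N * ‖ξ‖ * K := D.wnorm_free_le ξ
  have hmain : wnorm θ z ≤ C₁ * (wnorm θ r + ‖ξ‖) := by
    have h1 : wnorm θ z = wnorm θ fun t =>
        (E.mild N (fun s => h₁ s + E.incl (h₂ s)) t + E.mild N r t) + free ξ t :=
      wnorm_congr fun t ht => by rw [heq t ht, D.mild_add hh hr]
    have h2 := wnorm_add_le ((D.memLp_mild hh).add (D.memLp_mild hr)) (D.memLp_free ξ)
    have h3 := wnorm_add_le (D.memLp_mild hh) (D.memLp_mild hr)
    have h4 : wnorm θ z ≤ q * wnorm θ z + √(E.eigval N) / d * wnorm θ r + N * ‖ξ‖ * K := by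
      rw [h1] at hw1 ⊢
      refine h2.trans (add_le_add (h3.trans (add_le_add ?_ hw2)) hw3)
      exact hw1
    have h5 : (1 - q) * wnorm θ z ≤ (√(E.eigval N) / d + N * K) * (wnorm θ r + ‖ξ‖) := by
      have e1 : 0 ≤ √(E.eigval N) / d * ‖ξ‖ := by positivity
      have e2 : 0 ≤ N * K * wnorm θ r := by positivity
      linarith
    rw [hC₁, div_mul_eq_mul_div, le_div_iff₀ hq2]
    linarith
  have hS : 0 ≤ wnorm θ r + ‖ξ‖ := by positivity
  refine ⟨hmain.trans (by gcongr; linarith), fun t ht => ?_⟩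
  have hb1 : wnorm θ h₁ ≤ L₁ * wnorm θ z := by
    refine wnorm_le_of_forall L₁.2 hz fun t ht => ?_
    rw [mul_left_comm]
    gcongr
    exact hz₁ t ht
  have hb2 : wnorm θ (fun s => E.incl (h₂ s)) ≤ i * L₂ * wnorm θ z := by
    refine wnorm_le_of_forall (by positivity) hz fun t ht => ?_
    rw [mul_left_comm]
    gcongr
    rw [mul_assoc]
    exact (E.norm_incl_le _).trans (mul_le_mul_of_nonneg_left (hz₂ t ht) (by positivity))
  have hb3 : wnorm θ (fun s => h₁ s + E.incl (h₂ s) + r s) ≤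
      (L₁ + i * L₂) * wnorm θ z + wnorm θ r := by
    have e1 := wnorm_add_le hh hr
    have e2 := wnorm_add_le hh₁ (memLp_incl hh₂)
    linarith
  have hb4 : Real.exp (d * t) ≤ 1 := Real.exp_le_one_iff.2 (mul_nonpos_of_nonneg_of_nonpos hd.le ht)
  calc Real.exp (θ * t) * ‖z t‖
      ≤ Real.exp (θ * t) * ‖E.mild N (fun s => h₁ s + E.incl (h₂ s) + r s) t‖ +
          Real.exp (θ * t) * ‖free ξ t‖ := by
        rw [heq t ht, ← mul_add]
        gcongr
        exact norm_add_le _ _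
    _ ≤ c * wnorm θ (fun s => h₁ s + E.incl (h₂ s) + r s) + N * ‖ξ‖ * Real.exp (d * t) :=
        add_le_add (D.exp_mul_norm_mild_le hhr t) (D.exp_mul_norm_free_le ξ ht)
    _ ≤ c * ((L₁ + i * L₂) * (C₁ * (wnorm θ r + ‖ξ‖)) + (wnorm θ r + ‖ξ‖)) +
          N * (wnorm θ r + ‖ξ‖) * 1 := by
        have e0 : ‖ξ‖ ≤ wnorm θ r + ‖ξ‖ := by linarith
        have e1 : (L₁ + i * L₂) * wnorm θ z + wnorm θ r ≤
            (L₁ + i * L₂) * (C₁ * (wnorm θ r + ‖ξ‖)) + (wnorm θ r + ‖ξ‖) := by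
          have : 0 ≤ ‖ξ‖ := norm_nonneg _
          gcongr
          linarith
        gcongr
        exact hb3.trans e1
    _ = C₂ * (wnorm θ r + ‖ξ‖) := by rw [hC₂]; ring
    _ ≤ _ := by gcongr; linarith

/-- The integral equation with a Lipschitz nonlinearity has a solution in `L²_θ`. -/
theorem exists_integral_solution {L₁ L₂ : ℝ≥0} (hL : √(E.eigval N) * L₁ + L₂ < d)
    {G₁ : ℝ → E.H1 → H} {G₂ : ℝ → E.H1 → E.H1}
    (hm₁ : ∀ v : ℝ → E.H1, AEStronglyMeasurable v (volume.restrict (Iic 0)) →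
      AEStronglyMeasurable (fun t => G₁ t (v t)) (volume.restrict (Iic 0)))
    (hm₂ : ∀ v : ℝ → E.H1, AEStronglyMeasurable v (volume.restrict (Iic 0)) →
      AEStronglyMeasurable (fun t => G₂ t (v t)) (volume.restrict (Iic 0)))
    (hL₁ : ∀ t ≤ 0, ∀ x y, ‖G₁ t x - G₁ t y‖ ≤ L₁ * ‖x - y‖)
    (hL₂ : ∀ t ≤ 0, ∀ x y, ‖G₂ t x - G₂ t y‖ ≤ L₂ * ‖x - y‖)
    (h0₁ : MemLp (fun t => G₁ t 0) 2 (expWeight θ))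
    (h0₂ : MemLp (fun t => G₂ t 0) 2 (expWeight θ)) (p : E.PN N) :
    ∃ v : ℝ → E.H1, MemLp v 2 (expWeight θ) ∧
      MemLp (fun s => G₁ s (v s) + E.incl (G₂ s (v s))) 2 (expWeight θ) ∧
      ∀ t, v t = E.mild N (fun s => G₁ s (v s) + E.incl (G₂ s (v s))) t + free p t := by
  have hd := D.d_pos
  have hmem : ∀ {X : Type _} [NormedAddCommGroup X] {G : ℝ → E.H1 → X} {L : ℝ≥0},
      (∀ v : ℝ → E.H1, AEStronglyMeasurable v (volume.restrict (Iic 0)) →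
        AEStronglyMeasurable (fun t => G t (v t)) (volume.restrict (Iic 0))) →
      (∀ t ≤ 0, ∀ x y, ‖G t x - G t y‖ ≤ L * ‖x - y‖) →
      MemLp (fun t => G t 0) 2 (expWeight θ) → ∀ {v : ℝ → E.H1}, MemLp v 2 (expWeight θ) →
      MemLp (fun t => G t (v t)) 2 (expWeight θ) := by
    intro X _ G L hm hGL h0 v hv
    have h1 : MemLp (fun t => G t (v t) - G t 0) 2 (expWeight θ) := by
      refine memLp_of_forall (c := L) L.2 ?_ hv fun t ht => ?_
      · exact (hm v (aestronglyMeasurable_expWeight_iff.1 hv.1)).sub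
          (aestronglyMeasurable_expWeight_iff.1 h0.1)
      · rw [mul_left_comm]
        gcongr
        simpa using hGL t ht (v t) 0
    have h2 := h1.add h0
    refine h2.ae_eq (ae_of_all _ fun t => ?_)
    simp
  have hG₁ := fun {v} => hmem hm₁ hL₁ h0₁ (v := v)
  have hG₂ := fun {v} => hmem hm₂ hL₂ h0₂ (v := v)
  have hG : ∀ {v : ℝ → E.H1}, MemLp v 2 (expWeight θ) →
      MemLp (fun s => G₁ s (v s) + E.incl (G₂ s (v s))) 2 (expWeight θ) := fun hv =>
    (hG₁ hv).add (memLp_incl (hG₂ hv))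
  have hT : ∀ {v : ℝ → E.H1}, MemLp v 2 (expWeight θ) →
      MemLp (fun t => E.mild N (fun s => G₁ s (v s) + E.incl (G₂ s (v s))) t + free p t) 2
        (expWeight θ) := fun hv => (D.memLp_mild (hG hv)).add (D.memLp_free p)
  let Φ : Lp E.H1 2 (expWeight θ) → Lp E.H1 2 (expWeight θ) := fun v =>
    (hT (Lp.memLp v)).toLp _
  have hcontr : ContractingWith (Real.toNNReal ((√(E.eigval N) * L₁ + L₂) / d)) Φ := by
    refine ⟨?_, fun v w => ?_⟩
    · rw [Real.toNNReal_lt_one]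
      exact (div_lt_one hd).2 hL
    · rw [Lp.edist_toLp_toLp, Lp.edist_def]
      have hv := Lp.memLp v
      have hw := Lp.memLp w
      have h1 : ((fun t => E.mild N (fun s => G₁ s (v s) + E.incl (G₂ s (v s))) t + free p t) -
          fun t => E.mild N (fun s => G₁ s (w s) + E.incl (G₂ s (w s))) t + free p t) =
          E.mild N fun s => (G₁ s (v s) - G₁ s (w s)) + E.incl (G₂ s (v s) - G₂ s (w s)) := by
        funext t
        simp only [Pi.sub_apply, add_sub_add_right_eq_sub]
        rw [← D.mild_sub (hG hv) (hG hw)]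
        congr 1
        funext s
        rw [map_sub]
        abel
      rw [h1]
      exact D.eLpNorm_mild_add_incl_le (z := v - w) ((hG₁ hv).sub (hG₁ hw))
        ((hG₂ hv).sub (hG₂ hw)) (fun t ht => hL₁ t ht _ _) (fun t ht => hL₂ t ht _ _)
  have hfix : Φ (hcontr.fixedPoint) = hcontr.fixedPoint := hcontr.fixedPoint_isFixedPt
  set w := hcontr.fixedPoint with hw
  -- The fixed point is only a class modulo null sets. Evaluating the right side on it gives a
  -- representative that satisfies the equation at every time, because `mild` does not see null
  -- sets.
  set v : ℝ → E.H1 :=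
    fun t => E.mild N (fun s => G₁ s (w s) + E.incl (G₂ s (w s))) t + free p t with hv
  have hvw : v =ᵐ[volume.restrict (Iic 0)] w := by
    have h1 : v =ᵐ[expWeight θ] Φ w := (MemLp.coeFn_toLp (hT (Lp.memLp w))).symm
    rw [hfix] at h1
    exact ae_restrict_of_ae_expWeight h1
  have hvm : MemLp v 2 (expWeight θ) := hT (Lp.memLp w)
  refine ⟨v, hvm, hG hvm, fun t => ?_⟩
  rw [mild_congr_ae (g := fun s => G₁ s (w s) + E.incl (G₂ s (w s)))
    (hvw.mono fun s hs => by simp only [hs])]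

end Dichotomy

end EigenSystem

namespace EigenSystem

variable {H : Type*} [NormedAddCommGroup H] [InnerProductSpace ℝ H] [CompleteSpace H]
  {A : PosSelfAdjointOp H} {E : EigenSystem A} {N : ℕ} {θ d : ℝ}

/-! ### Weak solutions and the integral equation -/

/-- `v` solves the integral equation with right hand side `h` and initial value `p` in `L²_θ`. -/
structure IntegralSol (θ : ℝ) (h : ℝ → H) (p : E.PN N) (v : ℝ → E.H1) : Prop where
  memLp : MemLp v 2 (expWeight θ)
  memLp_rhs : MemLp h 2 (expWeight θ)
  eq : ∀ t ≤ 0, v t = E.mild N h t + free p t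

namespace IntegralSol

variable {h h' : ℝ → H} {p : E.PN N} {v v' : ℝ → E.H1}

lemma mono (hv : IntegralSol θ h p v) {θ' : ℝ} (hθ : θ ≤ θ') : IntegralSol θ' h p v :=
  ⟨memLp_expWeight_mono hθ hv.memLp, memLp_expWeight_mono hθ hv.memLp_rhs, hv.eq⟩

lemma congr (hv : IntegralSol θ h p v) (hh : ∀ t ≤ 0, h t = h' t) (hvv : ∀ t ≤ 0, v t = v' t) :
    IntegralSol θ h' p v' where
  memLp := hv.memLp.ae_eq (ae_expWeight_of_forall hvv)
  memLp_rhs := hv.memLp_rhs.ae_eq (ae_expWeight_of_forall hh)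
  eq t ht := by
    rw [← hvv t ht, hv.eq t ht,
      Dichotomy.mild_congr_ae ((ae_restrict_iff' measurableSet_Iic).2 (ae_of_all _ hh))]

end IntegralSol

namespace Dichotomy

variable (D : E.Dichotomy N θ d) {h g : ℝ → H} {p q : E.PN N} {v w : ℝ → E.H1}
include D

lemma integralSol_add (hv : IntegralSol θ h p v) (hw : IntegralSol θ g q w) :
    IntegralSol θ (fun t => h t + g t) (p + q) (fun t => v t + w t) :=
  ⟨hv.memLp.add hw.memLp, hv.memLp_rhs.add hw.memLp_rhs, fun t ht => by
    rw [hv.eq t ht, hw.eq t ht, D.mild_add hv.memLp_rhs hw.memLp_rhs, free_add]; abel⟩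

lemma integralSol_sub (hv : IntegralSol θ h p v) (hw : IntegralSol θ g q w) :
    IntegralSol θ (fun t => h t - g t) (p - q) (fun t => v t - w t) :=
  ⟨hv.memLp.sub hw.memLp, hv.memLp_rhs.sub hw.memLp_rhs, fun t ht => by
    rw [hv.eq t ht, hw.eq t ht, D.mild_sub hv.memLp_rhs hw.memLp_rhs, free_sub]; abel⟩

lemma integralSol_smul (hv : IntegralSol θ h p v) (c : ℝ) :
    IntegralSol θ (fun t => c • h t) (c • p) (fun t => c • v t) :=
  ⟨hv.memLp.const_smul c, hv.memLp_rhs.const_smul c, fun t ht => by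
    rw [hv.eq t ht, D.mild_smul hv.memLp_rhs, free_smul, smul_add]⟩

lemma continuousOn_integralSol (hv : IntegralSol θ h p v) : ContinuousOn v (Iic 0) :=
  ((D.continuousOn_mild hv.memLp_rhs).add (continuous_free p).continuousOn).congr hv.eq

lemma repr_incl_integralSol (hv : IntegralSol θ h p v) (k : ℕ) {t : ℝ} (ht : t ≤ 0) :
    E.basis.repr (E.incl (v t)) k =
      modeSol (decide (k < N)) (E.eigval k) (fun s => E.basis.repr (h s) k) t +
        Real.exp (-E.eigval k * t) * E.basis.repr (E.incl (p : E.H1)) k := by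
  have hs := (E.sqrt_eigval_pos k).ne'
  rw [hv.eq t ht, repr_incl, repr_incl, map_add, lp.coeFn_add, Pi.add_apply,
    D.repr_mild hv.memLp_rhs, repr_free]
  field_simp

end Dichotomy

/-- Symmetry of A moves it onto the eigenvector. This lets an arbitrary test function in D(A) be
expanded in modes. -/
lemma op_repr (E : EigenSystem A) (φ : A.op.domain) (k : ℕ) :
    E.basis.repr (A.op φ) k = E.eigval k * E.basis.repr (φ : H) k := by
  have h1 := LinearPMap.adjoint_isFormalAdjoint A.dense_domain
  rw [LinearPMap.isSelfAdjoint_def.1 A.selfAdjoint] at h1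
  have h2 := h1 ⟨E.basis k, E.basis_mem k⟩ φ
  rw [E.op_basis, real_inner_smul_left] at h2
  rw [E.basis.repr_apply_apply, E.basis.repr_apply_apply]
  exact h2.symm

lemma intervalIntegral_inner_left {f : ℝ → H} {s t : ℝ} (hf : IntervalIntegrable f volume s t)
    (x : H) : ∫ τ in s..t, ⟪f τ, x⟫ = ⟪∫ τ in s..t, f τ, x⟫ := by
  have h := (innerSL ℝ x).intervalIntegral_comp_comm hf
  simp only [innerSL_apply_apply] at h
  simpa only [real_inner_comm] using h

/-- A continuous function solves the equation iff all its modes do. -/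
lemma isSolution_iff_modes {h : ℝ → H} {v : ℝ → E.H1} (hh : ContinuousOn h (Iic 0))
    (hv : ContinuousOn v (Iic 0)) :
    E.IsSolution h v ↔ ∀ k (s t : ℝ), s ≤ t → t ≤ 0 →
      E.basis.repr (E.incl (v t)) k - E.basis.repr (E.incl (v s)) k +
        E.eigval k * ∫ τ in s..t, E.basis.repr (E.incl (v τ)) k =
        ∫ τ in s..t, E.basis.repr (h τ) k := by
  have hrepr : ∀ (x : H) k, E.basis.repr x k = ⟪x, E.basis k⟫ := fun x k => by
    rw [E.basis.repr_apply_apply, real_inner_comm]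
  have hii : ∀ {f : ℝ → H} {s t : ℝ}, ContinuousOn f (Iic 0) → s ≤ t → t ≤ 0 →
      IntervalIntegrable f volume s t := fun hf hst ht =>
    (hf.mono (by rw [uIcc_of_le hst]; exact fun x hx => hx.2.trans ht)).intervalIntegrable
  have hvi : ContinuousOn (fun t => E.incl (v t)) (Iic 0) := E.continuous_incl.comp_continuousOn hv
  constructor
  · rintro ⟨-, hsol⟩ k s t hst ht
    have h1 := hsol ⟨E.basis k, E.basis_mem k⟩ s t hst ht
    rw [E.op_basis] at h1
    simp only [real_inner_smul_right, intervalIntegral.integral_const_mul] at h1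
    simp only [hrepr]
    exact h1
  · intro hm
    refine ⟨hv, fun φ s t hst ht => ?_⟩
    rw [intervalIntegral_inner_left (hii hvi hst ht), intervalIntegral_inner_left (hii hh hst ht)]
    set a : H := E.incl (v t) - E.incl (v s) - ∫ τ in s..t, h τ with ha
    set b : H := ∫ τ in s..t, E.incl (v τ) with hb
    have hab : ∀ k, ⟪a, E.basis k⟫ = -(E.eigval k * ⟪b, E.basis k⟫) := by
      intro k
      have h1 := hm k s t hst ht
      simp only [hrepr] at h1
      rw [intervalIntegral_inner_left (hii hvi hst ht),
        intervalIntegral_inner_left (hii hh hst ht)] at h1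
      rw [ha, inner_sub_left, inner_sub_left]
      linarith
    have h1 := E.basis.hasSum_inner_mul_inner a (φ : H)
    have h2 := (E.basis.hasSum_inner_mul_inner b (A.op φ)).neg
    -- The factor λ_k is carried by the coordinates of Aφ, so both Parseval series converge and
    -- agree term by term; v itself need not lie in D(A).
    have h3 : (fun k => -(⟪b, E.basis k⟫ * ⟪E.basis k, A.op φ⟫)) =
        fun k => ⟪a, E.basis k⟫ * ⟪E.basis k, (φ : H)⟫ := by
      funext k
      rw [hab, ← E.basis.repr_apply_apply, ← E.basis.repr_apply_apply, op_repr]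
      ring
    rw [h3] at h2
    have h4 := h1.unique h2
    rw [ha, inner_sub_left, inner_sub_left] at h4
    linarith

namespace Dichotomy

variable (D : E.Dichotomy N θ d) {h : ℝ → H} {p : E.PN N} {v : ℝ → E.H1}
include D

lemma isSolution_of_integralSol (hh : ContinuousOn h (Iic 0)) (hv : IntegralSol θ h p v) :
    E.IsSolution h v := by
  rw [isSolution_iff_modes hh (D.continuousOn_integralSol hv)]
  intro k s t hst ht
  refine integrated_ode_of_formula (u := fun t => E.basis.repr (E.incl (v t)) k)
    (h := fun s => E.basis.repr (h s) k) (c := modeSol (decide (k < N)) (E.eigval k) (fun s => E.basis.repr (h s) k) 0 +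
      E.basis.repr (E.incl (p : E.H1)) k)
    ((continuous_repr_apply E.basis k).comp_continuousOn hh) (fun τ hτ => ?_) hst ht
  simp only
  rw [D.repr_incl_integralSol hv k hτ,
    modeSol_eq (D.dist_pos k) (D.modeGap k) (memLp_repr hv.memLp_rhs k) hτ]
  ring

lemma projection_of_integralSol (hv : IntegralSol θ h p v) :
    (E.PN N).orthogonalProjectionOnto (v 0) = p := by
  rw [orthogonalProjectionOnto_eq_iff]
  intro k hk
  rw [h1Basis_repr, h1Basis_repr, D.repr_incl_integralSol hv k le_rfl]
  simp [hk, modeSol_true_zero]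

lemma integralSol_of_isSolution (hh : ContinuousOn h (Iic 0)) (hhm : MemLp h 2 (expWeight θ))
    (hvm : MemLp v 2 (expWeight θ)) (hsol : E.IsSolution h v)
    (hp : (E.PN N).orthogonalProjectionOnto (v 0) = p) : IntegralSol θ h p v := by
  set u : ℝ → E.H1 := fun t => E.mild N h t + free p t with hu
  have hus : IntegralSol θ h p u :=
    ⟨(D.memLp_mild hhm).add (D.memLp_free p), hhm, fun t _ => rfl⟩
  have huc := D.continuousOn_integralSol hus
  have hmu := (isSolution_iff_modes hh huc).1 (D.isSolution_of_integralSol hh hus)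
  have hmv := (isSolution_iff_modes hh hsol.1).1 hsol
  refine ⟨hvm, hhm, fun t ht => ?_⟩
  change v t = u t
  refine ext_repr E.h1Basis fun k => ?_
  rw [h1Basis_repr, h1Basis_repr]
  congr 1
  set z : ℝ → ℝ := fun t => E.basis.repr (E.incl (v t)) k - E.basis.repr (E.incl (u t)) k with hz
  suffices hzt : z t = 0 from sub_eq_zero.1 hzt
  have hcoord : ∀ {y : ℝ → E.H1}, ContinuousOn y (Iic 0) →
      ContinuousOn (fun t => E.basis.repr (E.incl (y t)) k) (Iic 0) := fun hy =>
    ((continuous_repr_apply E.basis k).comp E.continuous_incl).comp_continuousOn hy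
  have hzc : ContinuousOn z (Iic 0) := (hcoord hsol.1).sub (hcoord huc)
  have hexp : ∀ t ≤ 0, z t = Real.exp (-E.eigval k * t) * z 0 := by
    intro t ht
    refine eq_exp_of_integrated_ode hzc (fun s t hst ht => ?_) ht
    have hii : ∀ {f : ℝ → ℝ}, ContinuousOn f (Iic 0) → IntervalIntegrable f volume s t :=
      fun hf => (hf.mono (by
        rw [uIcc_of_le hst]; exact fun x hx => hx.2.trans ht)).intervalIntegrable
    have h1 := hmu k s t hst ht
    have h2 := hmv k s t hst ht
    simp only [hz]
    rw [intervalIntegral.integral_sub (hii (hcoord hsol.1)) (hii (hcoord huc))]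
    linarith
  suffices hz0 : z 0 = 0 by rw [hexp t ht, hz0, mul_zero]
  -- A low mode is fixed by the projection at 0. For a high mode, λ_k > θ makes e^{θt}|z(t)| at
  -- least |z(0)| on ℝ₋, so z ∈ L²_θ forces a constant to be square integrable on a half-line, hence
  -- to vanish.
  by_cases hk : k < N
  · have h1 := orthogonalProjectionOnto_eq_iff.1 hp k hk
    have h2 := orthogonalProjectionOnto_eq_iff.1 (D.projection_of_integralSol hus) k hk
    have h3 := h1.trans h2.symm
    rw [h1Basis_repr, h1Basis_repr] at h3
    exact sub_eq_zero.2 (mul_left_cancel₀ (E.sqrt_eigval_pos k).ne' h3)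
  · have hzm : MemLp z 2 (expWeight θ) :=
      (memLp_repr (memLp_incl hvm) k).sub (memLp_repr (memLp_incl hus.memLp) k)
    have hle : wsq 0 (fun _ : ℝ => z 0) ≤ ENNReal.ofReal 1 ^ 2 * wsq θ z := by
      refine wsq_le_of_forall zero_le_one fun t ht => ?_
      rw [hexp t ht, norm_mul, Real.norm_of_nonneg (Real.exp_pos _).le, zero_mul, Real.exp_zero,
        one_mul, one_mul, ← mul_assoc, ← Real.exp_add]
      refine le_mul_of_one_le_left (norm_nonneg _) (Real.one_le_exp ?_)
      have h1 := D.high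
      have h2 := E.mono (not_lt.1 hk)
      have h3 := D.d_pos
      nlinarith
    have hlt := hle.trans_lt
      (ENNReal.mul_lt_top (by finiteness) (memLp_iff_wsq.1 hzm).2)
    by_contra hne
    simp [wsq, hne] at hlt

end Dichotomy

end EigenSystem

/-! ### Hölder estimates for the nonlinearities -/

section Holder

variable {X Y : Type*} [NormedAddCommGroup X] [NormedSpace ℝ X] [NormedAddCommGroup Y]
  [NormedSpace ℝ Y]

/-- `F` is `C^1` with Lipschitz constant `L`, and its derivative is `ε`-Hölder with constant `K`. -/
structure HolderC1 (ε K : ℝ) (L : ℝ≥0) (F : X → Y) : Prop where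
  nonneg : 0 ≤ K
  contDiff : ContDiff ℝ 1 F
  lipschitz : LipschitzWith L F
  holder : ∀ x y, ‖fderiv ℝ F x - fderiv ℝ F y‖ ≤ K * ‖x - y‖ ^ ε

namespace HolderC1

variable {ε K : ℝ} {L : ℝ≥0} {F : X → Y} (hF : HolderC1 ε K L F)
include hF

lemma continuous_fderiv : Continuous (fderiv ℝ F) := hF.contDiff.continuous_fderiv one_ne_zero

lemma norm_fderiv_apply_le (x w : X) : ‖fderiv ℝ F x w‖ ≤ L * ‖w‖ :=
  (fderiv ℝ F x).le_of_opNorm_le (norm_fderiv_le_of_lipschitz ℝ hF.lipschitz) w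

lemma norm_sub_le (x y : X) : ‖F x - F y‖ ≤ L * ‖x - y‖ := hF.lipschitz.norm_sub_le x y

lemma taylor (hε : 0 ≤ ε) (x y : X) :
    ‖F y - F x - fderiv ℝ F x (y - x)‖ ≤ K * ‖y - x‖ ^ ε * ‖y - x‖ := by
  refine (convex_segment x y).norm_image_sub_le_of_norm_fderiv_le' (𝕜 := ℝ)
    (fun z _ => hF.contDiff.differentiable one_ne_zero z) (fun z hz => ?_)
    (left_mem_segment ℝ x y) (right_mem_segment ℝ x y)
  refine (hF.holder z x).trans ?_
  have h1 : ‖z - x‖ ≤ ‖y - x‖ := norm_sub_le_of_mem_segment hz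
  have := hF.nonneg
  gcongr

end HolderC1

lemma IsCb.exists_holderC1 {n : ℕ} (hn : 1 ≤ n) {F : X → Y} (hF : IsCb (n + 1) F) {L : ℝ≥0}
    (hL : LipschitzWith L F) {ε : ℝ} (hε0 : 0 < ε) (hε1 : ε ≤ 1) : ∃ K, HolderC1 ε K L F := by
  have hC2 : ContDiff ℝ 2 F := hF.1.of_le (by exact_mod_cast Nat.succ_le_succ hn)
  obtain ⟨C, hC⟩ := hF.2 2 (by omega)
  have hd : Differentiable ℝ (fderiv ℝ F) :=
    (hC2.fderiv_right (m := 1) (by norm_num)).differentiable one_ne_zero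
  have hC0 : 0 ≤ C := (norm_nonneg _).trans (hC 0)
  have hbd : ∀ x, ‖fderiv ℝ (fderiv ℝ F) x‖ ≤ C := fun x => by
    rw [← norm_iteratedFDeriv_one, norm_iteratedFDeriv_fderiv]
    exact hC x
  have hlip : ∀ x y, ‖fderiv ℝ F x - fderiv ℝ F y‖ ≤ C * ‖x - y‖ := fun x y =>
    convex_univ.norm_image_sub_le_of_norm_fderiv_le (𝕜 := ℝ) (fun z _ => hd z)
      (fun z _ => hbd z) (mem_univ y) (mem_univ x)
  -- Nearby points use the bound C on the second derivative and t ≤ t^ε for t ≤ 1; distant points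
  -- use the bound 2L on the difference of derivatives and t^ε ≥ 1.
  refine ⟨C + 2 * L, by positivity, hC2.of_le (by norm_num), hL, fun x y => ?_⟩
  have hb : ∀ x, ‖fderiv ℝ F x‖ ≤ L := fun x => norm_fderiv_le_of_lipschitz ℝ hL
  rcases le_total ‖x - y‖ 1 with h | h
  · have h1 : ‖x - y‖ ≤ ‖x - y‖ ^ ε := by
      simpa using Real.rpow_le_rpow_of_exponent_ge_of_imp (norm_nonneg (x - y)) h hε1
        (fun _ h => absurd h one_ne_zero)
    calc _ ≤ C * ‖x - y‖ := hlip x y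
      _ ≤ (C + 2 * L) * ‖x - y‖ ^ ε := by gcongr; linarith [L.2]
  · have h1 : 1 ≤ ‖x - y‖ ^ ε := Real.one_le_rpow h hε0.le
    have h2 : ‖fderiv ℝ F x - fderiv ℝ F y‖ ≤ 2 * L := by
      refine (_root_.norm_sub_le _ _).trans ?_
      linarith [hb x, hb y]
    have h3 : (0 : ℝ) ≤ L := L.2
    nlinarith

/-- A map with a Taylor estimate of order `1 + ε` and `ε`-Hölder candidates for the derivative is
`C^{1,ε}`. -/
lemma isC1Holder_of_taylor [FiniteDimensional ℝ X] {f : X → Y} (f' : X → X →ₗ[ℝ] Y) {ε C : ℝ}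
    (hε : 0 < ε) (hC : 0 ≤ C)
    (htaylor : ∀ p q, ‖f q - f p - f' p (q - p)‖ ≤ C * ‖q - p‖ ^ ε * ‖q - p‖)
    (hholder : ∀ p q ξ, ‖f' p ξ - f' q ξ‖ ≤ C * ‖p - q‖ ^ ε * ‖ξ‖) :
    IsC1Holder ε f ∧ ∀ p ξ, HasFDerivAt f (LinearMap.toContinuousLinearMap (f' p)) p ∧
      fderiv ℝ f p ξ = f' p ξ := by
  have hlim : ∀ p : X, Filter.Tendsto (fun q => C * ‖q - p‖ ^ ε) (nhds p) (nhds 0) := by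
    intro p
    have hc : Continuous fun q : X => C * ‖q - p‖ ^ ε :=
      continuous_const.mul ((continuous_norm.comp (continuous_id.sub continuous_const)).rpow_const
        fun _ => Or.inr hε.le)
    simpa [Real.zero_rpow hε.ne'] using hc.tendsto p
  have hd : ∀ p, HasFDerivAt f (LinearMap.toContinuousLinearMap (f' p)) p := by
    intro p
    rw [hasFDerivAt_iff_isLittleO, Asymptotics.isLittleO_iff]
    intro c hc
    filter_upwards [(hlim p).eventually_lt_const hc] with q hq
    refine (htaylor p q).trans ?_
    gcongr
  have hfd : fderiv ℝ f = fun p => LinearMap.toContinuousLinearMap (f' p) :=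
    funext fun p => (hd p).fderiv
  have hH : ∀ p q, ‖fderiv ℝ f p - fderiv ℝ f q‖ ≤ C * ‖p - q‖ ^ ε := by
    intro p q
    refine ContinuousLinearMap.opNorm_le_bound _ (by positivity) fun ξ => ?_
    rw [hfd]
    exact hholder p q ξ
  refine ⟨⟨contDiff_one_iff_fderiv.2 ⟨fun p => (hd p).differentiableAt, ?_⟩, C, hH⟩,
    fun p ξ => ⟨hd p, by rw [hfd]; rfl⟩⟩
  rw [continuous_iff_continuousAt]
  intro p
  rw [ContinuousAt, tendsto_iff_norm_sub_tendsto_zero]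
  exact squeeze_zero (fun _ => norm_nonneg _) (fun q => hH q p) (hlim p)

end Holder

/-- A product of a small power of a function growing like `e^{-θt}` and a function of `L²_θ` lies in
`L²_{(1+ε)θ}`. -/
lemma memLp_and_wnorm_le_of_rpow_mul {X₁ X₂ Y : Type*} [NormedAddCommGroup X₁]
    [NormedAddCommGroup X₂] [NormedAddCommGroup Y] {θ ε K B : ℝ} (hε : 0 ≤ ε) (hK : 0 ≤ K)
    (hB : 0 ≤ B) {y : ℝ → X₁} {w : ℝ → X₂} {r : ℝ → Y}
    (hr : AEStronglyMeasurable r (volume.restrict (Iic 0))) (hw : MemLp w 2 (expWeight θ))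
    (hy : ∀ t ≤ 0, Real.exp (θ * t) * ‖y t‖ ≤ B)
    (hle : ∀ t ≤ 0, ‖r t‖ ≤ K * ‖y t‖ ^ ε * ‖w t‖) :
    MemLp r 2 (expWeight ((1 + ε) * θ)) ∧
      wnorm ((1 + ε) * θ) r ≤ K * B ^ ε * wnorm θ w := by
  have h : ∀ t ≤ 0, Real.exp ((1 + ε) * θ * t) * ‖r t‖ ≤
      K * B ^ ε * (Real.exp (θ * t) * ‖w t‖) := by
    intro t ht
    have he : Real.exp ((1 + ε) * θ * t) = Real.exp (θ * t) ^ ε * Real.exp (θ * t) := by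
      rw [← Real.exp_mul, ← Real.exp_add]
      congr 1; ring
    calc Real.exp ((1 + ε) * θ * t) * ‖r t‖
        ≤ Real.exp (θ * t) ^ ε * Real.exp (θ * t) * (K * ‖y t‖ ^ ε * ‖w t‖) := by
          rw [he]
          gcongr
          exact hle t ht
      _ = K * (Real.exp (θ * t) * ‖y t‖) ^ ε * (Real.exp (θ * t) * ‖w t‖) := by
          rw [Real.mul_rpow (Real.exp_pos _).le (norm_nonneg _)]; ring
      _ ≤ _ := by
          gcongr
          exact hy t ht
  have hc : 0 ≤ K * B ^ ε := by positivity
  exact ⟨memLp_of_forall hc hr hw h, wnorm_le_of_forall hc hw h⟩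

namespace EigenSystem

variable {H : Type*} [NormedAddCommGroup H] [InnerProductSpace ℝ H] [CompleteSpace H]
  {A : PosSelfAdjointOp H} {E : EigenSystem A} {N : ℕ} {θ d : ℝ}

/-! ### The nonlinear problem and the equation of variations -/

/-- The right hand side `F₁(v) + F₂(v)`. -/
def nonlin (F₁ : E.H1 → H) (F₂ : E.H1 → E.H1) (v : ℝ → E.H1) (t : ℝ) : H :=
  F₁ (v t) + E.incl (F₂ (v t))

/-- The linearization `F₁'(v) w + F₂'(v) w` of the right hand side. -/
def linearized (F₁ : E.H1 → H) (F₂ : E.H1 → E.H1) (v w : ℝ → E.H1) (t : ℝ) : H :=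
  fderiv ℝ F₁ (v t) (w t) + E.incl (fderiv ℝ F₂ (v t) (w t))

section Nemytskii

variable {Y : Type*} [NormedAddCommGroup Y] [NormedSpace ℝ Y] {ε K : ℝ} {L : ℝ≥0}
  {F : E.H1 → Y}

lemma aestronglyMeasurable_fderiv_apply (hF : HolderC1 ε K L F) {v w : ℝ → E.H1} {μ : Measure ℝ}
    (hv : AEStronglyMeasurable v μ) (hw : AEStronglyMeasurable w μ) :
    AEStronglyMeasurable (fun t => fderiv ℝ F (v t) (w t)) μ :=
  isBoundedBilinearMap_apply.continuous.comp_aestronglyMeasurable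
    ((hF.continuous_fderiv.comp_aestronglyMeasurable hv).prodMk hw)

lemma memLp_fderiv_apply (hF : HolderC1 ε K L F) {v w : ℝ → E.H1}
    (hv : AEStronglyMeasurable v (volume.restrict (Iic 0))) (hw : MemLp w 2 (expWeight θ)) :
    MemLp (fun t => fderiv ℝ F (v t) (w t)) 2 (expWeight θ) :=
  hw.of_le_mul (aestronglyMeasurable_fderiv_apply hF
    (aestronglyMeasurable_expWeight_iff.2 hv) hw.1)
    (ae_of_all _ fun t => hF.norm_fderiv_apply_le (v t) (w t))

lemma memLp_comp (hθ : 0 < θ) (hF : HolderC1 ε K L F) {v : ℝ → E.H1}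
    (hv : MemLp v 2 (expWeight θ)) : MemLp (fun t => F (v t)) 2 (expWeight θ) := by
  have h1 : MemLp (fun t => F (v t) - F 0) 2 (expWeight θ) :=
    hv.of_le_mul ((hF.lipschitz.continuous.comp_aestronglyMeasurable hv.1).sub
      aestronglyMeasurable_const) (ae_of_all _ fun t => by simpa using hF.norm_sub_le (v t) 0)
  refine (h1.add (memLp_const_expWeight hθ (F 0))).ae_eq (ae_of_all _ fun t => ?_)
  simp

end Nemytskii

variable {ε K₁ K₂ : ℝ} {L₁ L₂ : ℝ≥0} {F₁ : E.H1 → H} {F₂ : E.H1 → E.H1}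

lemma continuousOn_nonlin (hF₁ : HolderC1 ε K₁ L₁ F₁) (hF₂ : HolderC1 ε K₂ L₂ F₂) {v : ℝ → E.H1}
    {s : Set ℝ} (hv : ContinuousOn v s) : ContinuousOn (nonlin F₁ F₂ v) s :=
  (hF₁.lipschitz.continuous.comp_continuousOn hv).add
    (E.continuous_incl.comp_continuousOn (hF₂.lipschitz.continuous.comp_continuousOn hv))

lemma continuousOn_linearized (hF₁ : HolderC1 ε K₁ L₁ F₁) (hF₂ : HolderC1 ε K₂ L₂ F₂)
    {v w : ℝ → E.H1} {s : Set ℝ} (hv : ContinuousOn v s) (hw : ContinuousOn w s) :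
    ContinuousOn (linearized F₁ F₂ v w) s :=
  ((hF₁.continuous_fderiv.comp_continuousOn hv).clm_apply hw).add
    (E.continuous_incl.comp_continuousOn
      ((hF₂.continuous_fderiv.comp_continuousOn hv).clm_apply hw))

lemma memLp_nonlin (hθ : 0 < θ) (hF₁ : HolderC1 ε K₁ L₁ F₁) (hF₂ : HolderC1 ε K₂ L₂ F₂)
    {v : ℝ → E.H1} (hv : MemLp v 2 (expWeight θ)) : MemLp (nonlin F₁ F₂ v) 2 (expWeight θ) :=
  (memLp_comp hθ hF₁ hv).add (Dichotomy.memLp_incl (memLp_comp hθ hF₂ hv))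

lemma memLp_linearized (hF₁ : HolderC1 ε K₁ L₁ F₁) (hF₂ : HolderC1 ε K₂ L₂ F₂) {v w : ℝ → E.H1}
    (hv : AEStronglyMeasurable v (volume.restrict (Iic 0))) (hw : MemLp w 2 (expWeight θ)) :
    MemLp (linearized F₁ F₂ v w) 2 (expWeight θ) :=
  (memLp_fderiv_apply hF₁ hv hw).add (Dichotomy.memLp_incl (memLp_fderiv_apply hF₂ hv hw))

namespace Dichotomy

section

variable (D : E.Dichotomy N θ d) (hL : √(E.eigval N) * L₁ + L₂ < d)
  (hF₁ : HolderC1 ε K₁ L₁ F₁) (hF₂ : HolderC1 ε K₂ L₂ F₂)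
include D hL hF₁ hF₂

theorem exists_integralSol_nonlin (p : E.PN N) :
    ∃ v : ℝ → E.H1, IntegralSol θ (nonlin F₁ F₂ v) p v := by
  obtain ⟨v, hv, hm, heq⟩ := D.exists_integral_solution hL (G₁ := fun _ => F₁)
    (G₂ := fun _ => F₂)
    (fun v hv => hF₁.lipschitz.continuous.comp_aestronglyMeasurable hv)
    (fun v hv => hF₂.lipschitz.continuous.comp_aestronglyMeasurable hv)
    (fun _ _ => hF₁.norm_sub_le) (fun _ _ => hF₂.norm_sub_le)
    (memLp_const_expWeight D.theta_pos _) (memLp_const_expWeight D.theta_pos _) p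
  exact ⟨v, hv, hm, fun t _ => heq t⟩

theorem exists_integralSol_linearized {v : ℝ → E.H1}
    (hv : AEStronglyMeasurable v (volume.restrict (Iic 0))) (ξ : E.PN N) :
    ∃ w : ℝ → E.H1, IntegralSol θ (linearized F₁ F₂ v w) ξ w := by
  obtain ⟨w, hw, hm, heq⟩ := D.exists_integral_solution hL
    (G₁ := fun t => fderiv ℝ F₁ (v t)) (G₂ := fun t => fderiv ℝ F₂ (v t))
    (fun w hw => aestronglyMeasurable_fderiv_apply hF₁ hv hw)
    (fun w hw => aestronglyMeasurable_fderiv_apply hF₂ hv hw)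
    (fun t _ x y => by rw [← map_sub]; exact hF₁.norm_fderiv_apply_le _ _)
    (fun t _ x y => by rw [← map_sub]; exact hF₂.norm_fderiv_apply_le _ _)
    (by simp) (by simp) ξ
  exact ⟨w, hw, hm, fun t _ => heq t⟩

/-- Two solutions of the nonlinear problem differ by at most a multiple of the initial values. -/
theorem exists_nonlin_lipschitz :
    ∃ C : ℝ, 0 ≤ C ∧ ∀ {p q : E.PN N} {v u : ℝ → E.H1},
      IntegralSol θ (nonlin F₁ F₂ v) p v → IntegralSol θ (nonlin F₁ F₂ u) q u →
      wnorm θ (fun t => u t - v t) ≤ C * ‖q - p‖ ∧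
        ∀ t ≤ 0, Real.exp (θ * t) * ‖u t - v t‖ ≤ C * ‖q - p‖ := by
  obtain ⟨C, hC0, hC⟩ := D.exists_apriori hL
  refine ⟨C, hC0, fun {p q v u} hv hu => ?_⟩
  have hs := D.integralSol_sub hu hv
  have h0 : MemLp (fun _ : ℝ => (0 : H)) 2 (expWeight θ) := MemLp.zero
  have h1 := hC (r := fun _ => 0) hs.memLp
    ((memLp_comp D.theta_pos hF₁ hu.memLp).sub (memLp_comp D.theta_pos hF₁ hv.memLp))
    ((memLp_comp D.theta_pos hF₂ hu.memLp).sub (memLp_comp D.theta_pos hF₂ hv.memLp)) h0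
    (fun t _ => hF₁.norm_sub_le _ _) (fun t _ => hF₂.norm_sub_le _ _) (ξ := q - p)
    (fun t ht => by
      rw [hs.eq t ht]
      congr 2
      funext s
      simp only [nonlin, Pi.sub_apply, map_sub, add_zero]
      abel)
  have h2 : wnorm θ (fun _ : ℝ => (0 : H)) = 0 := by
    simp [wnorm]
  rw [h2, zero_add] at h1
  exact h1

/-- A priori estimate for the inhomogeneous equation of variations. -/
theorem exists_linearized_bound :
    ∃ C : ℝ, 0 ≤ C ∧ ∀ {v z : ℝ → E.H1} {r : ℝ → H} {ξ : E.PN N},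
      AEStronglyMeasurable v (volume.restrict (Iic 0)) → MemLp r 2 (expWeight θ) →
      IntegralSol θ (fun t => linearized F₁ F₂ v z t + r t) ξ z →
      wnorm θ z ≤ C * (wnorm θ r + ‖ξ‖) ∧
        ∀ t ≤ 0, Real.exp (θ * t) * ‖z t‖ ≤ C * (wnorm θ r + ‖ξ‖) := by
  obtain ⟨C, hC0, hC⟩ := D.exists_apriori hL
  refine ⟨C, hC0, fun {v z r ξ} hv hr hz => ?_⟩
  exact hC hz.memLp (memLp_fderiv_apply hF₁ hv hz.memLp) (memLp_fderiv_apply hF₂ hv hz.memLp) hr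
    (fun t _ => hF₁.norm_fderiv_apply_le _ _) (fun t _ => hF₂.norm_fderiv_apply_le _ _) hz.eq

theorem nonlin_unique {p : E.PN N} {v u : ℝ → E.H1} (hv : IntegralSol θ (nonlin F₁ F₂ v) p v)
    (hu : IntegralSol θ (nonlin F₁ F₂ u) p u) : EqOn u v (Iic 0) := by
  obtain ⟨C, -, hC⟩ := D.exists_nonlin_lipschitz hL hF₁ hF₂
  intro t ht
  have h := (hC hv hu).2 t ht
  rw [sub_self, norm_zero, mul_zero] at h
  have h1 := nonpos_of_mul_nonpos_right h (Real.exp_pos _)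
  exact sub_eq_zero.1 (norm_le_zero_iff.1 h1)

theorem exists_linearized_hom_bound :
    ∃ C : ℝ, 0 ≤ C ∧ ∀ {v z : ℝ → E.H1} {ξ : E.PN N},
      AEStronglyMeasurable v (volume.restrict (Iic 0)) →
      IntegralSol θ (linearized F₁ F₂ v z) ξ z →
      wnorm θ z ≤ C * ‖ξ‖ ∧ ∀ t ≤ 0, Real.exp (θ * t) * ‖z t‖ ≤ C * ‖ξ‖ := by
  obtain ⟨C, hC0, hC⟩ := D.exists_linearized_bound hL hF₁ hF₂
  refine ⟨C, hC0, fun {v z ξ} hv hz => ?_⟩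
  have h := hC (r := fun _ => 0) hv MemLp.zero (by simpa using hz)
  have h2 : wnorm θ (fun _ : ℝ => (0 : H)) = 0 := by simp [wnorm]
  rwa [h2, zero_add] at h

theorem linearized_unique {v : ℝ → E.H1} (hv : AEStronglyMeasurable v (volume.restrict (Iic 0)))
    {ξ : E.PN N} {w z : ℝ → E.H1} (hw : IntegralSol θ (linearized F₁ F₂ v w) ξ w)
    (hz : IntegralSol θ (linearized F₁ F₂ v z) ξ z) : EqOn z w (Iic 0) := by
  obtain ⟨C, -, hC⟩ := D.exists_linearized_hom_bound hL hF₁ hF₂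
  intro t ht
  have hs := D.integralSol_sub hz hw
  have h := (hC (z := fun t => z t - w t) hv (hs.congr (fun t _ => by
    simp only [linearized, map_sub]; abel) fun _ _ => rfl)).2 t ht
  rw [sub_self, norm_zero, mul_zero] at h
  have h1 := nonpos_of_mul_nonpos_right h (Real.exp_pos _)
  exact sub_eq_zero.1 (norm_le_zero_iff.1 h1)

end

section

variable {d' : ℝ} (D : E.Dichotomy N θ d) (D' : E.Dichotomy N ((1 + ε) * θ) d')
  (hL : √(E.eigval N) * L₁ + L₂ < d) (hL' : √(E.eigval N) * L₁ + L₂ < d') (hε : 0 < ε)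
  (hF₁ : HolderC1 ε K₁ L₁ F₁) (hF₂ : HolderC1 ε K₂ L₂ F₂)
include D D' hL hL' hε hF₁ hF₂

/-- Taylor estimate for the dependence of solutions on the initial value. -/
theorem exists_taylor :
    ∃ C : ℝ, 0 ≤ C ∧ ∀ {p q : E.PN N} {v u w : ℝ → E.H1},
      IntegralSol θ (nonlin F₁ F₂ v) p v → IntegralSol θ (nonlin F₁ F₂ u) q u →
      IntegralSol θ (linearized F₁ F₂ v w) (q - p) w →
      wnorm ((1 + ε) * θ) (fun t => u t - v t - w t) ≤ C * ‖q - p‖ ^ ε * ‖q - p‖ ∧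
        ∀ t ≤ 0, Real.exp ((1 + ε) * θ * t) * ‖u t - v t - w t‖ ≤
          C * ‖q - p‖ ^ ε * ‖q - p‖ := by
  obtain ⟨C, hC0, hC⟩ := D.exists_nonlin_lipschitz hL hF₁ hF₂
  obtain ⟨C', hC'0, hC'⟩ := D'.exists_linearized_bound hL' hF₁ hF₂
  have hθ : θ ≤ (1 + ε) * θ := by nlinarith [D.theta_pos]
  have hK₁ := hF₁.nonneg
  have hK₂ := hF₂.nonneg
  set K : ℝ := K₁ + (√(E.eigval 0))⁻¹ * K₂ with hK
  have hK0 : 0 ≤ K := by positivity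
  refine ⟨C' * (K * C ^ ε * C), by positivity, fun {p q v u w} hv hu hw => ?_⟩
  set r : ℝ → H := fun t => nonlin F₁ F₂ u t - nonlin F₁ F₂ v t -
    linearized F₁ F₂ v (fun t => u t - v t) t with hr
  have huv : MemLp (fun t => u t - v t) 2 (expWeight θ) := hu.memLp.sub hv.memLp
  have hvm := aestronglyMeasurable_expWeight_iff.1 hv.memLp.1
  have hrm : AEStronglyMeasurable r (volume.restrict (Iic 0)) :=
    aestronglyMeasurable_expWeight_iff.1
      ((hu.memLp_rhs.sub hv.memLp_rhs).sub (memLp_linearized hF₁ hF₂ hvm huv)).1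
  obtain ⟨hlip, hpt⟩ := hC hv hu
  -- The Taylor remainder is at most K‖u - v‖^ε ‖u - v‖: the first factor is bounded pointwise, the
  -- second in L²_θ.
  obtain ⟨hr1, hr2⟩ := memLp_and_wnorm_le_of_rpow_mul (θ := θ) (y := fun t => u t - v t)
    (w := fun t => u t - v t) hε.le hK0 (by positivity : 0 ≤ C * ‖q - p‖) hrm huv hpt
    (fun t _ => by
      have e : r t = (F₁ (u t) - F₁ (v t) - fderiv ℝ F₁ (v t) (u t - v t)) +
          E.incl (F₂ (u t) - F₂ (v t) - fderiv ℝ F₂ (v t) (u t - v t)) := by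
        simp only [hr, nonlin, linearized, map_sub]; abel
      rw [e]
      refine (norm_add_le _ _).trans ((add_le_add (hF₁.taylor hε.le _ _)
        ((E.norm_incl_le _).trans (mul_le_mul_of_nonneg_left (hF₂.taylor hε.le _ _)
          (by positivity)))).trans_eq ?_)
      rw [hK]; ring)
  -- The remainder solves the equation of variations along v with zero initial value and forcing r.
  -- It is viewed at the weight (1+ε)θ because r is of order 1 + ε there.
  have hz : IntegralSol ((1 + ε) * θ)
      (fun t => linearized F₁ F₂ v (fun t => u t - v t - w t) t + r t) (0 : E.PN N)
      (fun t => u t - v t - w t) := by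
    have h1 := (D.integralSol_sub (D.integralSol_sub hu hv) hw).mono hθ
    rw [sub_self] at h1
    refine h1.congr (fun t _ => ?_) fun _ _ => rfl
    simp only [hr, linearized, map_sub]; abel
  have h := hC' hvm hr1 hz
  rw [norm_zero, add_zero] at h
  have hfin : C' * wnorm ((1 + ε) * θ) r ≤
      C' * (K * C ^ ε * C) * ‖q - p‖ ^ ε * ‖q - p‖ := by
    calc C' * wnorm ((1 + ε) * θ) r
        ≤ C' * (K * (C * ‖q - p‖) ^ ε * (C * ‖q - p‖)) := by
          gcongr
          exact hr2.trans (by gcongr)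
      _ = _ := by rw [Real.mul_rpow hC0 (norm_nonneg _)]; ring
  exact ⟨h.1.trans hfin, fun t ht => (h.2 t ht).trans hfin⟩

/-- Hölder dependence of the solutions of the equation of variations on the base point. -/
theorem exists_linearized_holder :
    ∃ C : ℝ, 0 ≤ C ∧ ∀ {p q ξ : E.PN N} {v u w z : ℝ → E.H1},
      IntegralSol θ (nonlin F₁ F₂ v) p v → IntegralSol θ (nonlin F₁ F₂ u) q u →
      IntegralSol θ (linearized F₁ F₂ v w) ξ w → IntegralSol θ (linearized F₁ F₂ u z) ξ z →
      wnorm ((1 + ε) * θ) (fun t => w t - z t) ≤ C * ‖p - q‖ ^ ε * ‖ξ‖ ∧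
        ∀ t ≤ 0, Real.exp ((1 + ε) * θ * t) * ‖w t - z t‖ ≤ C * ‖p - q‖ ^ ε * ‖ξ‖ := by
  obtain ⟨C, hC0, hC⟩ := D.exists_nonlin_lipschitz hL hF₁ hF₂
  obtain ⟨C', hC'0, hC'⟩ := D'.exists_linearized_bound hL' hF₁ hF₂
  obtain ⟨C₂, hC₂0, hC₂⟩ := D.exists_linearized_hom_bound hL hF₁ hF₂
  have hθ : θ ≤ (1 + ε) * θ := by nlinarith [D.theta_pos]
  have hK₁ := hF₁.nonneg
  have hK₂ := hF₂.nonneg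
  set K : ℝ := K₁ + (√(E.eigval 0))⁻¹ * K₂ with hK
  have hK0 : 0 ≤ K := by positivity
  refine ⟨C' * (K * C ^ ε * C₂), by positivity, fun {p q ξ v u w z} hv hu hw hz => ?_⟩
  have hvm := aestronglyMeasurable_expWeight_iff.1 hv.memLp.1
  have hum := aestronglyMeasurable_expWeight_iff.1 hu.memLp.1
  -- The difference w - z is treated as a solution linearized along v; changing the base point from
  -- u to v produces the forcing (F'(v) - F'(u))z.
  set r : ℝ → H := fun t => linearized F₁ F₂ v z t - linearized F₁ F₂ u z t with hr
  have hrm : AEStronglyMeasurable r (volume.restrict (Iic 0)) :=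
    aestronglyMeasurable_expWeight_iff.1
      ((memLp_linearized hF₁ hF₂ hvm hz.memLp).sub hz.memLp_rhs).1
  have hpt := (hC hu hv).2
  have hbound : ∀ {Y : Type _} [NormedAddCommGroup Y] [NormedSpace ℝ Y] {F : E.H1 → Y} {K : ℝ}
      {L : ℝ≥0}, HolderC1 ε K L F → ∀ t, ‖fderiv ℝ F (v t) (z t) - fderiv ℝ F (u t) (z t)‖ ≤
        K * ‖v t - u t‖ ^ ε * ‖z t‖ := by
    intro Y _ _ F K L hF t
    rw [← _root_.sub_apply]
    exact ContinuousLinearMap.le_of_opNorm_le _ (hF.holder _ _) _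
  obtain ⟨hr1, hr2⟩ := memLp_and_wnorm_le_of_rpow_mul (θ := θ) (y := fun t => v t - u t)
    (w := z) hε.le hK0 (by positivity : 0 ≤ C * ‖p - q‖) hrm hz.memLp hpt
    (fun t _ => by
      have e : r t = (fderiv ℝ F₁ (v t) (z t) - fderiv ℝ F₁ (u t) (z t)) +
          E.incl (fderiv ℝ F₂ (v t) (z t) - fderiv ℝ F₂ (u t) (z t)) := by
        simp only [hr, linearized, map_sub]; abel
      rw [e]
      refine (norm_add_le _ _).trans ((add_le_add (hbound hF₁ t)
        ((E.norm_incl_le _).trans (mul_le_mul_of_nonneg_left (hbound hF₂ t)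
          (by positivity)))).trans_eq ?_)
      rw [hK]; ring)
  have hs : IntegralSol ((1 + ε) * θ)
      (fun t => linearized F₁ F₂ v (fun t => w t - z t) t + r t) (0 : E.PN N)
      (fun t => w t - z t) := by
    have h1 := (D.integralSol_sub hw hz).mono hθ
    rw [sub_self] at h1
    refine h1.congr (fun t _ => ?_) fun _ _ => rfl
    simp only [hr, linearized, map_sub]; abel
  have h := hC' hvm hr1 hs
  rw [norm_zero, add_zero] at h
  have hfin : C' * wnorm ((1 + ε) * θ) r ≤ C' * (K * C ^ ε * C₂) * ‖p - q‖ ^ ε * ‖ξ‖ := by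
    calc C' * wnorm ((1 + ε) * θ) r
        ≤ C' * (K * (C * ‖p - q‖) ^ ε * (C₂ * ‖ξ‖)) := by
          gcongr
          exact hr2.trans (by gcongr; exact (hC₂ hum hz).1)
      _ = _ := by rw [Real.mul_rpow hC0 (norm_nonneg _)]; ring
  exact ⟨h.1.trans hfin, fun t ht => (h.2 t ht).trans hfin⟩

end

end Dichotomy

end EigenSystem

/-! ### Assembling the Perron map and its derivative -/

lemma IsC1Holder.clm_comp {X Y Z : Type*} [NormedAddCommGroup X] [NormedSpace ℝ X]
    [NormedAddCommGroup Y] [NormedSpace ℝ Y] [NormedAddCommGroup Z] [NormedSpace ℝ Z] {ε : ℝ}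
    {f : X → Y} (hf : IsC1Holder ε f) (T : Y →L[ℝ] Z) : IsC1Holder ε fun x => T (f x) := by
  obtain ⟨hd, C, hC⟩ := hf
  refine ⟨T.contDiff.comp hd, ‖T‖ * C, fun x y => ?_⟩
  have hfd : ∀ x, fderiv ℝ (fun x => T (f x)) x = T.comp (fderiv ℝ f x) := fun x =>
    (T.hasFDerivAt.comp x (hd.differentiable one_ne_zero x).hasFDerivAt).fderiv
  rw [hfd, hfd, ← ContinuousLinearMap.comp_sub, mul_assoc]
  exact (ContinuousLinearMap.opNorm_comp_le _ _).trans
    (mul_le_mul_of_nonneg_left (hC x y) (norm_nonneg _))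

namespace EigenSystem

variable {H : Type*} [NormedAddCommGroup H] [InnerProductSpace ℝ H] [CompleteSpace H]
  {A : PosSelfAdjointOp H} {E : EigenSystem A} {N : ℕ} {θ d : ℝ}

namespace Dichotomy

variable {d' ε K₁ K₂ : ℝ} {L₁ L₂ : ℝ≥0} {F₁ : E.H1 → H} {F₂ : E.H1 → E.H1}
  (D : E.Dichotomy N θ d) (D' : E.Dichotomy N ((1 + ε) * θ) d')
  (hL : √(E.eigval N) * L₁ + L₂ < d) (hL' : √(E.eigval N) * L₁ + L₂ < d') (hε : 0 < ε)
  (hF₁ : HolderC1 ε K₁ L₁ F₁) (hF₂ : HolderC1 ε K₂ L₂ F₂)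

include D hL hF₁ hF₂ in
lemma isPerronMap {V : E.PN N → ℝ → E.H1} (hV : ∀ p, IntegralSol θ (nonlin F₁ F₂ (V p)) p (V p)) :
    E.IsPerronMap F₁ F₂ θ N V := by
  refine fun p => ⟨⟨(hV p).memLp, D.isSolution_of_integralSol
    (continuousOn_nonlin hF₁ hF₂ (D.continuousOn_integralSol (hV p))) (hV p),
    D.projection_of_integralSol (hV p)⟩, ?_⟩
  rintro v ⟨hv, hsol, hp⟩
  exact D.nonlin_unique hL hF₁ hF₂ (hV p) (D.integralSol_of_isSolution
    (continuousOn_nonlin hF₁ hF₂ hsol.1) (memLp_nonlin D.theta_pos hF₁ hF₂ hv) hv hsol hp)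

include D hL hF₁ hF₂ in
lemma isVariationSolution_and_unique {v w : ℝ → E.H1} (hv : ContinuousOn v (Iic 0)) {ξ : E.PN N}
    (hw : IntegralSol θ (linearized F₁ F₂ v w) ξ w) :
    E.IsVariationSolution F₁ F₂ θ N v ξ w ∧
      ∀ z, E.IsVariationSolution F₁ F₂ θ N v ξ z → EqOn z w (Iic 0) := by
  have hvm : AEStronglyMeasurable v (volume.restrict (Iic 0)) :=
    hv.aestronglyMeasurable measurableSet_Iic
  refine ⟨⟨hw.memLp, D.isSolution_of_integralSol
    (continuousOn_linearized hF₁ hF₂ hv (D.continuousOn_integralSol hw)) hw,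
    D.projection_of_integralSol hw⟩, ?_⟩
  rintro z ⟨hz, hsol, hξ⟩
  exact D.linearized_unique hL hF₁ hF₂ hvm hw (D.integralSol_of_isSolution
    (continuousOn_linearized hF₁ hF₂ hv hsol.1) (memLp_linearized hF₁ hF₂ hvm hz) hz hsol hξ)

include D D' hL hL' hε hF₁ hF₂ in
/-- The Perron method under a spectral gap around `θ` and `(1 + ε) θ`. -/
theorem exists_perronMap : ∃ V : E.PN N → ℝ → E.H1,
    E.IsPerronMap F₁ F₂ θ N V ∧
    (∀ t ≤ 0, IsC1Holder ε fun p => V p t) ∧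
    (∃ hV : ∀ p, MemLp (V p) 2 (expWeight ((1 + ε) * θ)),
      IsC1Holder ε fun p => (hV p).toLp (V p)) ∧
    (Set.range fun p => V p 0) = (Set.range fun p : E.PN N => (p : E.H1) + graphMap V p) ∧
    IsC1Holder ε (graphMap V) ∧
    (∀ p ξ : E.PN N,
      E.IsVariationSolution F₁ F₂ θ N (V p) ξ (derivV V p ξ) ∧
      (∀ w, E.IsVariationSolution F₁ F₂ θ N (V p) ξ w → Set.EqOn w (derivV V p ξ) (Set.Iic 0)) ∧
      fderiv ℝ (graphMap V) p ξ = (E.PN N)ᗮ.orthogonalProjectionOnto (derivV V p ξ 0)) ∧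
    ∃ C : ℝ, ∀ p₁ p₂ : E.PN N,
      eLpNorm (fun t => V p₂ t - V p₁ t - derivV V p₁ (p₂ - p₁) t) 2
        (expWeight ((1 + ε) * θ)) ≤ ENNReal.ofReal (C * ‖p₂ - p₁‖ ^ (1 + ε)) := by
  choose V hV using D.exists_integralSol_nonlin hL hF₁ hF₂
  have hVm : ∀ p, AEStronglyMeasurable (V p) (volume.restrict (Iic 0)) := fun p =>
    aestronglyMeasurable_expWeight_iff.1 (hV p).memLp.1
  choose W hW using fun p => D.exists_integralSol_linearized hL hF₁ hF₂ (hVm p)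
  obtain ⟨C₁, hC₁0, hC₁⟩ := D.exists_taylor D' hL hL' hε hF₁ hF₂
  obtain ⟨C₂, hC₂0, hC₂⟩ := D.exists_linearized_holder D' hL hL' hε hF₁ hF₂
  have hθ : θ ≤ (1 + ε) * θ := by nlinarith [D.theta_pos]
  -- Linearity in the initial value follows from uniqueness for the equation of variations. It holds
  -- only for t ≤ 0, which is why the derivative is identified only there.
  have hWadd : ∀ p ξ η, ∀ t ≤ 0, W p (ξ + η) t = W p ξ t + W p η t := fun p ξ η =>
    D.linearized_unique hL hF₁ hF₂ (w := fun t => W p ξ t + W p η t) (hVm p)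
      ((D.integralSol_add (hW p ξ) (hW p η)).congr
        (fun t _ => by simp only [linearized, map_add]; abel) fun _ _ => rfl) (hW p (ξ + η))
  have hWsmul : ∀ p (c : ℝ) ξ, ∀ t ≤ 0, W p (c • ξ) t = c • W p ξ t := fun p c ξ =>
    D.linearized_unique hL hF₁ hF₂ (w := fun t => c • W p ξ t) (hVm p)
      ((D.integralSol_smul (hW p ξ) c).congr
        (fun t _ => by simp only [linearized, map_smul, smul_add]) fun _ _ => rfl) (hW p (c • ξ))
  have hT : ∀ p q, _ := fun p q => hC₁ (hV p) (hV q) (hW p (q - p))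
  have hH : ∀ p q ξ, _ := fun p q ξ => hC₂ (hV p) (hV q) (hW p ξ) (hW q ξ)
  have hpoint : ∀ t ≤ 0, (IsC1Holder ε fun p => V p t) ∧ ∀ p ξ,
      DifferentiableAt ℝ (fun p => V p t) p ∧ fderiv ℝ (fun p => V p t) p ξ = W p ξ t := by
    intro t ht
    let Wt : E.PN N → E.PN N →ₗ[ℝ] E.H1 := fun p =>
      { toFun := fun ξ => W p ξ t
        map_add' := fun ξ η => hWadd p ξ η t ht
        map_smul' := fun c ξ => hWsmul p c ξ t ht }
    set e := Real.exp ((1 + ε) * θ * t) with he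
    have he0 : 0 < e := Real.exp_pos _
    have hdiv : ∀ {x y : ℝ}, e * x ≤ y → x ≤ e⁻¹ * y := fun h => by
      rwa [inv_mul_eq_div, le_div_iff₀' he0]
    obtain ⟨h1, h2⟩ := isC1Holder_of_taylor (f := fun p => V p t) Wt (C := e⁻¹ * (C₁ + C₂)) hε
      (by positivity) (fun p q => by
        refine (hdiv ((hT p q).2 t ht)).trans ?_
        rw [mul_assoc, mul_assoc, mul_assoc]
        gcongr
        linarith) (fun p q ξ => by
        refine (hdiv ((hH p q ξ).2 t ht)).trans ?_
        rw [mul_assoc, mul_assoc, mul_assoc]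
        gcongr
        linarith)
    exact ⟨h1, fun p ξ => ⟨(h2 p ξ).1.differentiableAt, (h2 p ξ).2⟩⟩
  have hderiv : ∀ p ξ, ∀ t ≤ 0, derivV V p ξ t = W p ξ t := fun p ξ t ht =>
    ((hpoint t ht).2 p ξ).2
  have hVm' : ∀ p, MemLp (V p) 2 (expWeight ((1 + ε) * θ)) := fun p => ((hV p).mono hθ).memLp
  have hWm' : ∀ p ξ, MemLp (W p ξ) 2 (expWeight ((1 + ε) * θ)) := fun p ξ =>
    ((hW p ξ).mono hθ).memLp
  have hperron := D.isPerronMap hL hF₁ hF₂ hV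
  have hgraph : graphMap V = fun p => (E.PN N)ᗮ.orthogonalProjectionOnto (V p 0) := rfl
  refine ⟨V, hperron, fun t ht => (hpoint t ht).1, ⟨hVm', ?_⟩, ?_, ?_, fun p ξ => ?_, C₁, ?_⟩
  -- The same Taylor and Hölder estimates, now in the L² norm, make the class of w the derivative of
  -- the class of V.
  · let WL : E.PN N → E.PN N →ₗ[ℝ] Lp E.H1 2 (expWeight ((1 + ε) * θ)) := fun p =>
      { toFun := fun ξ => (hWm' p ξ).toLp _
        map_add' := fun ξ η => by
          rw [← MemLp.toLp_add, MemLp.toLp_eq_toLp_iff]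
          exact ae_expWeight_of_forall (hWadd p ξ η)
        map_smul' := fun c ξ => by
          rw [RingHom.id_apply, ← MemLp.toLp_const_smul, MemLp.toLp_eq_toLp_iff]
          exact ae_expWeight_of_forall (hWsmul p c ξ) }
    refine (isC1Holder_of_taylor (f := fun p => (hVm' p).toLp (V p)) WL (C := C₁ + C₂) hε
      (by positivity) (fun p q => ?_) fun p q ξ => ?_).1
    · change ‖(hVm' q).toLp _ - (hVm' p).toLp _ - (hWm' p (q - p)).toLp _‖ ≤ _
      rw [← MemLp.toLp_sub, ← MemLp.toLp_sub, Lp.norm_toLp]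
      refine (hT p q).1.trans ?_
      gcongr
      linarith
    · change ‖(hWm' p ξ).toLp _ - (hWm' q ξ).toLp _‖ ≤ _
      rw [← MemLp.toLp_sub, Lp.norm_toLp]
      refine (hH p q ξ).1.trans ?_
      gcongr
      linarith
  · congr 1
    funext p
    have h1 := D.projection_of_integralSol (hV p)
    have h2 := Submodule.starProjection_add_starProjection_orthogonal (K := E.PN N) (V p 0)
    rw [Submodule.starProjection_apply, Submodule.starProjection_apply, h1] at h2
    exact h2.symm
  · rw [hgraph]
    exact (hpoint 0 le_rfl).1.clm_comp _
  · have hsol : IntegralSol θ (linearized F₁ F₂ (V p) (derivV V p ξ)) ξ (derivV V p ξ) :=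
      (hW p ξ).congr (fun t ht => by simp only [linearized, hderiv p ξ t ht])
        fun t ht => (hderiv p ξ t ht).symm
    obtain ⟨h1, h2⟩ := D.isVariationSolution_and_unique hL hF₁ hF₂
      (D.continuousOn_integralSol (hV p)) hsol
    refine ⟨h1, h2, ?_⟩
    have h3 := ((E.PN N)ᗮ.orthogonalProjectionOnto.hasFDerivAt.comp p
      ((hpoint 0 le_rfl).2 p ξ).1.hasFDerivAt).fderiv
    exact congrArg (fun T => T ξ) h3
  · intro p q
    have h1 : (fun t => V q t - V p t - derivV V p (q - p) t) =ᵐ[expWeight ((1 + ε) * θ)]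
        fun t => V q t - V p t - W p (q - p) t :=
      ae_expWeight_of_forall fun t ht => by simp only [hderiv p (q - p) t ht]
    have h2 : MemLp (fun t => V q t - V p t - W p (q - p) t) 2 (expWeight ((1 + ε) * θ)) :=
      ((hVm' q).sub (hVm' p)).sub (hWm' p (q - p))
    rw [eLpNorm_congr_ae h1, ← ofReal_wnorm h2]
    refine ENNReal.ofReal_le_ofReal ((hT p q).1.trans_eq ?_)
    -- Splitting the power 1 + ε into ε and 1 is done for a positive base, so coinciding points are
    -- treated apart.
    rcases eq_or_ne q p with rfl | hne
    · have : (1 + ε) ≠ 0 := by positivity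
      simp [Real.zero_rpow this]
    · rw [Real.rpow_add (norm_pos_iff.2 (sub_ne_zero.2 hne)), Real.rpow_one]; ring

end Dichotomy

/-! ### The spectral gap condition -/

lemma lam_nonneg (E : EigenSystem A) : ∀ k, 0 ≤ E.lam k
  | 0 => le_rfl
  | k + 1 => (E.eigval_pos k).le

section Gap

variable {n : ℕ} (hn : 1 ≤ n) {M : ℕ → ℕ} {L₁ L₂ : ℝ≥0}

lemma gapGamma_pos (h : ∀ i ∈ Finset.Icc 1 n, 0 < E.gapExcess M L₁ L₂ i) :
    0 < E.gapGamma hn M L₁ L₂ := by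
  rw [gapGamma, Finset.lt_inf'_iff]
  intro i hi
  have := h i hi
  positivity

lemma theta_pos (hγ : 0 < E.gapGamma hn M L₁ L₂) (i : ℕ) : 0 < E.theta hn M L₁ L₂ i := by
  have := E.lam_nonneg (M i)
  unfold theta
  positivity

/-- The gap condition separates `θ_i`, and slightly larger weights, from the spectrum. -/
lemma dichotomy_of_gap (hγ : 0 < E.gapGamma hn M L₁ L₂) {i : ℕ} (hi : i ∈ Finset.Icc 1 n)
    (hM : 1 ≤ M i) {τ : ℝ} (hτ0 : 0 ≤ τ) (hτ : τ < E.gapGamma hn M L₁ L₂) :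
    E.Dichotomy (M i) (E.theta hn M L₁ L₂ i + τ)
      (E.gapGamma hn M L₁ L₂ - τ + (√(E.eigval (M i)) * L₁ + L₂)) := by
  obtain ⟨m, hm⟩ : ∃ m, M i = m + 1 := ⟨M i - 1, by omega⟩
  have h1 : E.gapGamma hn M L₁ L₂ ≤ E.gapExcess M L₁ L₂ i / ((i : ℝ) + 1) :=
    Finset.inf'_le _ hi
  rw [le_div_iff₀ (by positivity), gapExcess] at h1
  have hi1 : (1 : ℝ) ≤ i := by exact_mod_cast (Finset.mem_Icc.1 hi).1
  have hl := E.lam_nonneg (M (i - 1))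
  have hlam : E.lam (M i + 1) = E.eigval (M i) := rfl
  have hth : E.theta hn M L₁ L₂ i =
      E.lam (M i) + E.gapGamma hn M L₁ L₂ + √(E.eigval (M i)) * L₁ + L₂ := rfl
  rw [hlam] at h1
  have ha : 0 ≤ √(E.eigval (M i)) * L₁ + L₂ := by positivity
  set a : ℝ := √(E.eigval (M i)) * L₁ + L₂ with haeq
  have hmul : 0 ≤ ((i : ℝ) - 1) * E.lam (M (i - 1)) := mul_nonneg (by linarith) hl
  -- Since i ≥ 1, the gap (i+1)(γ + a) is at least 2(γ + a), which leaves γ + a on each side of θ_i.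
  -- Raising θ_i by τ keeps at least γ - τ + a on both sides.
  have hmul2 : 0 ≤ ((i : ℝ) - 1) * (E.gapGamma hn M L₁ L₂ + a) :=
    mul_nonneg (by linarith) (by linarith)
  have h2 : E.gapGamma hn M L₁ L₂ * ((i : ℝ) + 1) ≤ E.eigval (M i) - E.lam (M i) -
      ((i : ℝ) - 1) * E.lam (M (i - 1)) - ((i : ℝ) + 1) * a := by
    rw [haeq]
    linarith
  refine ⟨by linarith, by linarith [theta_pos hn hγ i], fun k hk => ?_, ?_⟩
  · have h3 : E.eigval k ≤ E.lam (M i) := by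
      rw [hm]
      exact E.mono (by omega)
    rw [hth]
    linarith
  · rw [hth]
    linarith

end Gap

end EigenSystem

end InertialManifold
end

/-! ### The theorem: a choice of ε₀ common to all i -/

open InertialManifold
theorem proposition4p2 {H : Type*} [NormedAddCommGroup H] [InnerProductSpace ℝ H]
    [CompleteSpace H] (A : PosSelfAdjointOp H) (E : EigenSystem A)
    (n : ℕ) (hn : 1 ≤ n) (N : ℕ → ℕ) (hN0 : N 0 = 0) (hN : ∀ i ∈ Finset.Icc 1 n, 1 ≤ N i)
    (L₁ L₂ : ℝ≥0)
    (hgap : ∀ i ∈ Finset.Icc 1 n,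
      E.lam (N i + 1) - E.lam (N i) >
        ((i : ℝ) - 1) * E.lam (N (i - 1)) + √(E.lam (N i + 1)) * ((i : ℝ) + 1) * L₁
          + ((i : ℝ) + 1) * L₂) :
    ∃ ε₀ : ℝ, 0 < ε₀ ∧ ε₀ ≤ 1 ∧ ∀ ε : ℝ, 0 < ε → ε < ε₀ →
      ∀ (F₁ : E.H1 → H) (F₂ : E.H1 → E.H1),
        IsCb (n + 1) F₁ → IsCb (n + 1) F₂ → LipschitzWith L₁ F₁ → LipschitzWith L₂ F₂ →
        ∀ i ∈ Finset.Icc 1 n, ∃ V : E.PN (N i) → ℝ → E.H1,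
          E.IsPerronMap F₁ F₂ (E.theta hn N L₁ L₂ i) (N i) V ∧
          -- `V` is `C^{1,ε}`: for each fixed time, and with values in the weighted space
          (∀ t ≤ 0, IsC1Holder ε fun p => V p t) ∧
          (∃ hV : ∀ p, MemLp (V p) 2 (expWeight ((1 + ε) * E.theta hn N L₁ L₂ i)),
            IsC1Holder ε fun p => (hV p).toLp (V p)) ∧
          -- the manifold formed by the values `V(p, 0)` is the graph of the `C^{1,ε}` map `M`
          (Set.range fun p => V p 0) =
            (Set.range fun p : E.PN (N i) => (p : E.H1) + EigenSystem.graphMap V p) ∧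
          IsC1Holder ε (EigenSystem.graphMap V) ∧
          -- the derivative and the equation of variations
          (∀ p ξ : E.PN (N i),
            E.IsVariationSolution F₁ F₂ (E.theta hn N L₁ L₂ i) (N i) (V p) ξ
              (EigenSystem.derivV V p ξ) ∧
            (∀ w, E.IsVariationSolution F₁ F₂ (E.theta hn N L₁ L₂ i) (N i) (V p) ξ w →
              Set.EqOn w (EigenSystem.derivV V p ξ) (Set.Iic 0)) ∧
            fderiv ℝ (EigenSystem.graphMap V) p ξ =
              (E.PN (N i))ᗮ.orthogonalProjectionOnto (EigenSystem.derivV V p ξ 0)) ∧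
          -- the Taylor estimate
          ∃ C : ℝ, ∀ p₁ p₂ : E.PN (N i),
            eLpNorm (fun t => V p₂ t - V p₁ t - EigenSystem.derivV V p₁ (p₂ - p₁) t) 2
                (expWeight ((1 + ε) * E.theta hn N L₁ L₂ i)) ≤
              ENNReal.ofReal (C * ‖p₂ - p₁‖ ^ (1 + ε)) := by
  have hexc : ∀ i ∈ Finset.Icc 1 n, 0 < E.gapExcess N L₁ L₂ i := fun i hi => by
    have := hgap i hi
    rw [EigenSystem.gapExcess]
    linarith
  have hγ := EigenSystem.gapGamma_pos hn hexc
  have hθ := EigenSystem.theta_pos hn hγ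
  set γ := E.gapGamma hn N L₁ L₂ with hγdef
  -- The sum dominates every θ_i, so ε < γ/S gives εθ_i < γ for all i at once. The bound ε ≤ 1 is
  -- what the Hölder estimate for the derivatives of F₁ and F₂ needs.
  set S := ∑ i ∈ Finset.Icc 1 n, E.theta hn N L₁ L₂ i with hS
  have hS0 : 0 < S := Finset.sum_pos (fun i _ => hθ i) (Finset.nonempty_Icc.2 hn)
  refine ⟨min 1 (γ / S), by positivity, min_le_left _ _, ?_⟩
  intro ε hε hε₀ F₁ F₂ hF₁ hF₂ hL₁ hL₂ i hi
  have hε1 : ε ≤ 1 := (hε₀.trans_le (min_le_left _ _)).le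
  have hεS : ε * S < γ := (lt_div_iff₀ hS0).1 (hε₀.trans_le (min_le_right _ _))
  have hθS : E.theta hn N L₁ L₂ i ≤ S :=
    Finset.single_le_sum (f := fun i => E.theta hn N L₁ L₂ i) (fun j _ => (hθ j).le) hi
  have hτ : ε * E.theta hn N L₁ L₂ i < γ :=
    (mul_le_mul_of_nonneg_left hθS hε.le).trans_lt hεS
  have D := EigenSystem.dichotomy_of_gap hn hγ hi (hN i hi) le_rfl hγ
  have D' := EigenSystem.dichotomy_of_gap hn hγ hi (hN i hi) (mul_pos hε (hθ i)).le hτ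
  rw [add_zero] at D
  -- The raised weight θ_i + εθ_i is (1+ε)θ_i, and its distance γ - εθ_i + a to the spectrum still
  -- exceeds a.
  rw [← one_add_mul] at D'
  obtain ⟨K₁, hK₁⟩ := hF₁.exists_holderC1 hn hL₁ hε hε1
  obtain ⟨K₂, hK₂⟩ := hF₂.exists_holderC1 hn hL₂ hε hε1
  exact D.exists_perronMap D' (by linarith) (by linarith) hε hK₁ hK₂
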